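/- Let $n\ge 0$. A lattice path with $n$ unit steps (east or north) is identified with the set $B\subseteq[n]$ of its north steps. Let $U,L\subseteq[n]$ satisfy $|U|=|L|$ and $|L\cap[i]|\le|U\cap[i]|$ for all $i$. The lattice path matroid $M[U,L]$ is the matroid on $[n]$ whose bases are the sets $B\subseteq[n]$ with $|B|=|U|$ and $|L\cap[i]|\le|B\cap[i]|\le|U\cap[i]|$ for all $i$. A matroid $M'$ on $[n]$ is a quotient of a matroid $M$ on $[n]$ if there are a matroid $N$ on a finite set $E\supseteq[n]$ and $T=E\setminus[n]$ with $M=N\setminus T$ and $M'=N/T$. Let $\mathcal P_n$ be the poset of lattice path matroids on $[n]$, where $M'\le M$ means that $M'$ is a quotient of $M$. Let $\Lambda_n=[n]\times[n]$ be ordered by $(u',\ell')\le(u,\ell)$ if and only if $u\le u'$ and $\ell\le\ell'$. If $\ell$ is the $i$-th smallest element of $L$ and $u$ is the $j$-th smallest element of $U$, then $(\ell,u)$ is a good pair of $M[U,L]$ if $i\le j$ and $u-\ell\le j-i$. **Proposition.** The poset $\mathcal P_n$ is graded with rank function $M[U,L]\mapsto|U|$. For each cover $M'=M[U',L']\lessdot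 M=M[U,L]$ in $\mathcal P_n$ one has $U'\subseteq U$, $L'\subseteq L$, $U\setminus U'=\{u\}$ and $L\setminus L'=\{\ell\}$ for a good pair $(\ell,u)$ of $M$. Put $\lambda(M'\lessdot M)=(u,\ell)\in\Lambda_n$. Then this good pair labeling $\lambda$ is an EW-labeling. That is, reading the labels of a chain from the bottom to the top: 1. ($\lambda$ is an ER-labeling.) For all $x\le y$ in $\mathcal P_n$, the interval $[x,y]$ has a unique maximal chain whose labels are strictly increasing; it also has a unique maximal chain whose labels are weakly increasing. 2. (Rank two switching property.) If $x\lessdot y\lessdot z$ and $\lambda(x\lessdot y)<\lambda(y\lessdot z)$, then there is a unique $y'$ with $x\lessdot y'\lessdot z$, $\lambda(x\lessdot y')=\lambda(y\lessdot z)$ and $\lambda(y'\lessdot z)=\lambda(x\lessdot y)$. 3. In each interval $[x,y]$, two different falling maximal chains have different words of labels, where $x_0\lessdot\dots\lessdot x_k$ is falling if $\lambda(x_{i-1}\lessdot x_i)\not<\lambda(x_i\lessdot x_{i+1})$ for all $0<i<k$. Moreover $\mathcal P_n$ has a Whitney dual. That is, there is a finite poset $Q$ with a minimum $\hat 0$ and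 a rank function such that, for every $k$, $W_k(Q)=|w_k(\mathcal P_n)|$ and $|w_k(Q)|=W_k(\mathcal P_n)$. Here $W_k$ denotes the number of elements of rank $k$, and $w_k=\sum_{\rho(x)=k}\mu(\hat 0,x)$ is the sum of the values of the Möbius function over the elements of rank $k$. -/

import Mathlib

/-! ## Quotients of matroids -/

/-- `M'` is a quotient of `M` (both on the whole of `α`): there are finitely many new elements,
indexed by `Fin k`, and a matroid `N` on a ground set containing the set `T` of the new elements,
such that `M = N ＼ T` and `M' = N ／ T`. The old elements are embedded by `Sum.inl`. -/
def IsMatroidQuotient {α : Type*} (M' M : Matroid α) : Prop :=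
  ∃ (k : ℕ) (N : Matroid (α ⊕ Fin k)),
    Set.range Sum.inr ⊆ N.E ∧
    N.delete (Set.range Sum.inr) = M.map Sum.inl Sum.inl_injective.injOn ∧
    N.contract (Set.range Sum.inr) = M'.map Sum.inl Sum.inl_injective.injOn

namespace IsMatroidQuotient

variable {α : Type*} {M M' : Matroid α}

theorem closure_subset (h : IsMatroidQuotient M' M) (X : Set α) :
    M.closure X ⊆ M'.closure X := by
  obtain ⟨k, N, -, h1, h2⟩ := h
  have e1 := congrArg (fun K => K.closure (Sum.inl '' X)) h1
  have e2 := congrArg (fun K => K.closure (Sum.inl '' X)) h2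
  simp only [Matroid.map_closure_eq, Matroid.delete_closure_eq, Matroid.contract_closure_eq,
    Set.preimage_image_eq _ Sum.inl_injective] at e1 e2
  rw [← Set.image_subset_image_iff (Sum.inl_injective (β := Fin k)), ← e1, ← e2]
  refine Set.sdiff_subset_sdiff_left (N.closure_subset_closure ?_)
  exact Set.sdiff_subset.trans Set.subset_union_left

theorem of_closure_subset [Finite α] (hE : M.E = Set.univ) (hE' : M'.E = Set.univ)
    (h : ∀ X, M.closure X ⊆ M'.closure X) : IsMatroidQuotient M' M := by
  classical
  have := Fintype.ofFinite α
  have fin : ∀ X : Set α, M'.eRk X ≠ ⊤ := fun X =>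
    ((M'.eRk_le_encard X).trans_lt (Set.toFinite X).encard_lt_top).ne
  set r : Finset α → ℕ := fun X => (M'.eRk X).toNat with hr
  have hrc : ∀ X : Finset α, (r X : ℕ∞) = M'.eRk X := fun X => ENat.natCast_toNat (fin _)
  have rmono : ∀ {X Y : Finset α}, X ⊆ Y → r X ≤ r Y := by
    intro X Y hXY
    have := M'.eRk_mono (Finset.coe_subset.2 hXY)
    rw [← hrc, ← hrc] at this
    exact_mod_cast this
  have rins : ∀ (e : α) (X : Finset α), r (insert e X) ≤ r X + 1 := by
    intro e X
    have := M'.eRk_insert_le_add_one e (X : Set α)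
    rw [← Finset.coe_insert, ← hrc, ← hrc] at this
    exact_mod_cast this
  have rindep : ∀ X : Finset α, M'.Indep X ↔ X.card ≤ r X := by
    intro X
    rw [Matroid.indep_iff_eRk_eq_encard_of_finite X.finite_toSet, ← hrc,
      Set.encard_coe_eq_coe_finsetCard, Nat.cast_inj]
    have := M'.eRk_le_encard (X : Set α)
    rw [← hrc, Set.encard_coe_eq_coe_finsetCard] at this
    have : r X ≤ X.card := by exact_mod_cast this
    omega
  have raug : ∀ {X Y : Finset α}, r X < r Y →
      ∃ e ∈ Y, e ∉ M'.closure (X : Set α) ∧ r (insert e X) = r X + 1 := by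
    intro X Y hXY
    have h1 : M'.eRk X < M'.eRk Y := by rw [← hrc, ← hrc]; exact_mod_cast hXY
    obtain ⟨e, he, h2⟩ := Matroid.exists_eRk_insert_eq_add_one_of_lt h1
    refine ⟨e, he.1, fun hc => ?_, ?_⟩
    · have h3 := M'.eRk_insert_closure_eq e (X : Set α)
      rw [Set.insert_eq_of_mem hc, M'.eRk_closure_eq, h2, ← hrc] at h3
      have : r X = r X + 1 := by exact_mod_cast h3
      omega
    · rw [← Finset.coe_insert, ← hrc, ← hrc] at h2
      exact_mod_cast h2
  -- the linking matroid
  let k := Fintype.card α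
  let P : Finset (α ⊕ Fin k) → Prop := fun I =>
    M.Indep (I.toLeft : Set α) ∧ I.toLeft.card + I.toRight.card ≤ r I.toLeft + k
  have insL : ∀ (e : α) (I : Finset (α ⊕ Fin k)),
      (insert (Sum.inl e) I).toLeft = insert e I.toLeft := by
    intro e I; ext; simp
  have insL' : ∀ (e : α) (I : Finset (α ⊕ Fin k)),
      (insert (Sum.inl e) I).toRight = I.toRight := by
    intro e I; ext; simp
  have insR : ∀ (e : Fin k) (I : Finset (α ⊕ Fin k)),
      (insert (Sum.inr e) I).toLeft = I.toLeft := by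
    intro e I; ext; simp
  have insR' : ∀ (e : Fin k) (I : Finset (α ⊕ Fin k)),
      (insert (Sum.inr e) I).toRight = insert e I.toRight := by
    intro e I; ext; simp
  have Psub : ∀ ⦃I J⦄, P J → I ⊆ J → P I := by
    intro I J hJ hIJ
    have key : ∀ (e : α ⊕ Fin k) (I : Finset (α ⊕ Fin k)), e ∉ I → P (insert e I) → P I := by
      rintro (e | e) I he ⟨h1, h2⟩
      · rw [insL] at h1 h2
        rw [insL'] at h2
        refine ⟨h1.subset (by simp), ?_⟩
        have := rins e I.toLeft
        rw [Finset.card_insert_of_notMem (by simpa using he)] at h2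
        omega
      · rw [insR] at h1 h2
        rw [insR', Finset.card_insert_of_notMem (by simpa using he)] at h2
        exact ⟨h1, by omega⟩
    have : ∀ S : Finset (α ⊕ Fin k), Disjoint S I → P (S ∪ I) → P I := by
      intro S
      induction S using Finset.induction_on with
      | empty => intro _ h; simpa using h
      | insert a S ha ih =>
        intro hd hp
        rw [Finset.disjoint_insert_left] at hd
        refine ih hd.2 (key a _ ?_ (by rwa [← Finset.insert_union]))
        simp [ha, hd.1]
    refine this (J \ I) Finset.sdiff_disjoint ?_
    rwa [Finset.sdiff_union_of_subset hIJ]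
  have Paug : ∀ ⦃I J⦄, P I → P J → I.card < J.card → ∃ e ∈ J, e ∉ I ∧ P (insert e I) := by
    rintro I J ⟨hI1, hI2⟩ ⟨hJ1, hJ2⟩ hlt
    rw [← Finset.card_toLeft_add_card_toRight (u := I),
      ← Finset.card_toLeft_add_card_toRight (u := J)] at hlt
    have good : ∀ e ∈ J.toLeft, e ∉ M.closure (I.toLeft : Set α) →
        (I.toLeft.card + I.toRight.card + 1 ≤ r (insert e I.toLeft) + k) →
        ∃ e ∈ J, e ∉ I ∧ P (insert e I) := by
      intro e he hc hcard
      have heI : e ∉ I.toLeft := fun h' =>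
        hc (M.mem_closure_of_mem' (by simpa using h') (by simp [hE]))
      refine ⟨Sum.inl e, by simpa using he, by simpa using heI, ?_, ?_⟩
      · rw [insL, Finset.coe_insert]
        rw [hI1.insert_indep_iff]
        exact Or.inl ⟨by simp [hE], hc⟩
      · rw [insL, insL', Finset.card_insert_of_notMem heI]
        omega
    by_cases hs : I.toLeft.card + I.toRight.card < r I.toLeft + k
    · by_cases hY : J.toRight ⊆ I.toRight
      · have hlt' : I.toLeft.card < J.toLeft.card := by
          have := Finset.card_le_card hY
          omega
        obtain ⟨e, he, hc⟩ : ∃ e ∈ J.toLeft, e ∉ M.closure (I.toLeft : Set α) := by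
          by_contra! hcon
          have h1 := M.eRk_mono (show (J.toLeft : Set α) ⊆ M.closure I.toLeft from hcon)
          rw [M.eRk_closure_eq, hJ1.eRk_eq_encard, hI1.eRk_eq_encard,
            Set.encard_coe_eq_coe_finsetCard, Set.encard_coe_eq_coe_finsetCard] at h1
          have : J.toLeft.card ≤ I.toLeft.card := by exact_mod_cast h1
          omega
        refine good e he hc ?_
        have := rmono (Finset.subset_insert e I.toLeft)
        omega
      · obtain ⟨e, he, he'⟩ := Finset.not_subset.1 hY
        refine ⟨Sum.inr e, by simpa using he, by simpa using he', ?_, ?_⟩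
        · rwa [insR]
        · rw [insR, insR', Finset.card_insert_of_notMem he']
          omega
    · obtain ⟨e, he, hc, hre⟩ := raug (show r I.toLeft < r J.toLeft by omega)
      exact good e he (fun h' => hc (h _ h')) (by omega)
  have P_empty : P ∅ := by
    have h1 : (∅ : Finset (α ⊕ Fin k)).toLeft = ∅ := by ext; simp
    have h2 : (∅ : Finset (α ⊕ Fin k)).toRight = ∅ := by ext; simp
    simp only [P, h1, h2]
    simp
  let N : Matroid (α ⊕ Fin k) := (IndepMatroid.ofFinset Set.univ P
    P_empty Psub Paug (by simp)).matroid
  have hN : ∀ I : Finset (α ⊕ Fin k), N.Indep I ↔ P I := fun I => by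
    simp [N]
  have toL : ∀ X : Finset α, (X.map (Function.Embedding.inl (β := Fin k))).toLeft = X := by
    intro X; ext; simp
  have toR : ∀ X : Finset α, (X.map (Function.Embedding.inl (β := Fin k))).toRight = ∅ := by
    intro X; ext; simp
  have hNE : N.E = Set.univ := rfl
  have hcompl : (Set.univ : Set (α ⊕ Fin k)) \ Set.range Sum.inr = Set.range Sum.inl := by
    ext x; cases x <;> simp
  have mapI : ∀ (K : Matroid α) (X : Finset α),
      (K.map (Sum.inl : α → α ⊕ Fin k) Sum.inl_injective.injOn).Indep (Sum.inl '' (X : Set α)) ↔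
        K.Indep X := by
    intro K X
    rw [Matroid.map_indep_iff]
    constructor
    · rintro ⟨I₀, h1, h2⟩
      rwa [Sum.inl_injective.image_injective h2]
    · intro h1; exact ⟨_, h1, rfl⟩
  have form : ∀ I : Set (α ⊕ Fin k), I ⊆ Set.range Sum.inl →
      ∃ X : Finset α, I = Sum.inl '' (X : Set α) := by
    intro I hI
    refine ⟨(Sum.inl ⁻¹' I).toFinset, ?_⟩
    rw [Set.coe_toFinset, Set.image_preimage_eq_of_subset hI]
  have hT : N.Indep (Set.range Sum.inr) := by
    have : (Set.range Sum.inr : Set (α ⊕ Fin k)) =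
        ((Finset.univ.map Function.Embedding.inr : Finset (α ⊕ Fin k)) : Set (α ⊕ Fin k)) := by
      ext; simp
    rw [this, hN]
    have h1 : (Finset.univ.map Function.Embedding.inr : Finset (α ⊕ Fin k)).toLeft = ∅ := by
      ext; simp
    refine ⟨by simp [h1], ?_⟩
    rw [h1]
    have := Finset.card_le_univ (Finset.univ.map Function.Embedding.inr :
      Finset (α ⊕ Fin k)).toRight
    simp only [Fintype.card_fin] at this
    simp only [Finset.card_empty]
    omega
  refine ⟨k, N, by simp [hNE], ?_, ?_⟩
  · refine Matroid.ext_indep (by simp [hNE, hE, hcompl]) ?_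
    intro I hI
    rw [Matroid.delete_ground, hNE, hcompl] at hI
    obtain ⟨X, rfl⟩ := form I hI
    rw [mapI, Matroid.delete_indep_iff]
    have e : Sum.inl '' (X : Set α) =
        ((X.map (Function.Embedding.inl (β := Fin k)) : Finset _) : Set (α ⊕ Fin k)) := by
      ext; simp
    have hd : Disjoint (Sum.inl '' (X : Set α)) (Set.range (Sum.inr : Fin k → α ⊕ Fin k)) := by
      rw [Set.disjoint_left]; rintro _ ⟨x, _, rfl⟩; simp
    rw [and_iff_left hd, e, hN]
    simp only [P, toL, toR, Finset.card_empty]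
    refine and_iff_left ?_
    have : X.card ≤ k := Finset.card_le_univ X
    omega
  · refine Matroid.ext_indep (by simp [hNE, hE', hcompl]) ?_
    intro I hI
    rw [Matroid.contract_ground, hNE, hcompl] at hI
    obtain ⟨X, rfl⟩ := form I hI
    rw [mapI, hT.contract_indep_iff]
    have e : Sum.inl '' (X : Set α) ∪ Set.range Sum.inr =
        ((X.disjSum (Finset.univ : Finset (Fin k)) : Finset _) : Set (α ⊕ Fin k)) := by
      ext x; cases x <;> simp
    have hd : Disjoint (Sum.inl '' (X : Set α)) (Set.range (Sum.inr : Fin k → α ⊕ Fin k)) := by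
      rw [Set.disjoint_left]; rintro _ ⟨x, _, rfl⟩; simp
    rw [and_iff_right hd, e, hN]
    have h1 : (X.disjSum (Finset.univ : Finset (Fin k))).toLeft = X := by ext; simp
    have h2 : (X.disjSum (Finset.univ : Finset (Fin k))).toRight = Finset.univ := by ext; simp
    simp only [P, h1, h2, Finset.card_univ, Fintype.card_fin]
    constructor
    · rintro ⟨-, h3⟩
      exact (rindep X).2 (by omega)
    · intro h3
      refine ⟨?_, by have := (rindep X).1 h3; omega⟩
      rw [Matroid.indep_iff_forall_notMem_closure_sdiff (by simp [hE])]
      rw [Matroid.indep_iff_forall_notMem_closure_sdiff (by simp [hE'])] at h3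
      intro e he hc
      exact h3 he (h _ hc)

end IsMatroidQuotient

/-! ## Lattice path matroids -/

/-- The height of a lattice path after its first `i` steps. A path with `n` steps is given by the
set `B ⊆ Fin n` of its north steps. -/
def pathHeight {n : ℕ} (B : Finset (Fin n)) (i : ℕ) : ℕ :=
  (B.filter fun x : Fin n => (x : ℕ) < i).card

/-- The diagram of a lattice path matroid on the ground set `Fin n`: two lattice paths `U` and `L`
with the same endpoints, such that `L` never goes above `U`. -/
structure LPM (n : ℕ) where
  /-- the north steps of the upper path -/
  U : Finset (Fin n)
  /-- the north steps of the lower path -/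
  L : Finset (Fin n)
  card_eq : L.card = U.card
  noncrossing : ∀ i, pathHeight L i ≤ pathHeight U i

namespace LPM

/-- `B` is (the set of north steps of) a lattice path inside the diagram of `M`. -/
def IsPath {n : ℕ} (M : LPM n) (B : Finset (Fin n)) : Prop :=
  B.card = M.U.card ∧ ∀ i, pathHeight M.L i ≤ pathHeight B i ∧ pathHeight B i ≤ pathHeight M.U i

end LPM

theorem pathHeight_succ {n : ℕ} (B : Finset (Fin n)) (x : Fin n) :
    pathHeight B (x + 1) = pathHeight B x + if x ∈ B then 1 else 0 := by
  unfold pathHeight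
  split_ifs with h
  · rw [← Finset.card_insert_of_notMem (a := x) (by simp)]
    congr 1
    ext y
    simp only [Finset.mem_filter, Finset.mem_insert, Fin.ext_iff]
    constructor
    · rintro ⟨h1, h2⟩
      by_cases h3 : (y : ℕ) = x
      · exact Or.inl h3
      · exact Or.inr ⟨h1, by omega⟩
    · rintro (h1 | ⟨h1, h2⟩)
      · rw [← Fin.ext_iff] at h1
        subst h1
        exact ⟨h, by omega⟩
      · exact ⟨h1, by omega⟩
  · congr 1
    ext y
    simp only [Finset.mem_filter, and_congr_right_iff]
    intro hy
    have : (y : ℕ) ≠ x := fun e => h (Fin.ext e ▸ hy)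
    omega

theorem pathHeight_zero {n : ℕ} (B : Finset (Fin n)) : pathHeight B 0 = 0 := by
  simp [pathHeight]

theorem pathHeight_end {n : ℕ} (B : Finset (Fin n)) : pathHeight B n = B.card := by
  simp [pathHeight]

theorem pathHeight_insert {n : ℕ} (B : Finset (Fin n)) {y : Fin n} (hy : y ∉ B) (i : ℕ) :
    pathHeight (insert y B) i = pathHeight B i + if (y : ℕ) < i then 1 else 0 := by
  unfold pathHeight
  rw [Finset.filter_insert]
  split_ifs with h
  · rw [Finset.card_insert_of_notMem (by simp [hy])]
  · rfl

theorem eq_of_pathHeight_eq {n : ℕ} {B C : Finset (Fin n)}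
    (h : ∀ i, pathHeight B i = pathHeight C i) : B = C := by
  ext x
  have h1 := h (x + 1)
  rw [pathHeight_succ, pathHeight_succ, h x] at h1
  by_cases hB : x ∈ B <;> by_cases hC : x ∈ C <;> simp_all

namespace LPM

variable {n : ℕ}

theorem isPath_exchange (M : LPM n) {B C : Finset (Fin n)} (hB : M.IsPath B) (hC : M.IsPath C)
    {x : Fin n} (hxB : x ∈ B) (hxC : x ∉ C) :
    ∃ y ∈ C, y ∉ B ∧ M.IsPath (insert y (B.erase x)) := by
  have hx := pathHeight_succ B x
  have hx' := pathHeight_succ C x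
  rw [if_pos hxB] at hx
  rw [if_neg hxC] at hx'
  have hh : ∀ y : Fin n, y ∉ B → ∀ i, pathHeight (insert y (B.erase x)) i
      + (if (x : ℕ) < i then 1 else 0) = pathHeight B i + if (y : ℕ) < i then 1 else 0 := by
    intro y hy i
    rw [pathHeight_insert _ (by simp [hy])]
    have := pathHeight_insert (B.erase x) (y := x) (by simp) i
    rw [Finset.insert_erase hxB] at this
    omega
  have hcard : ∀ y : Fin n, y ∉ B → (insert y (B.erase x)).card = M.U.card := by
    intro y hy
    rw [Finset.card_insert_of_notMem (by simp [hy]), Finset.card_erase_add_one hxB, hB.1]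
  have hend : pathHeight B n = pathHeight C n := by
    rw [pathHeight_end, pathHeight_end, hB.1, hC.1]
  by_cases hd : pathHeight C (x + 1) < pathHeight B (x + 1)
  · have hex : ∃ j, (x : ℕ) + 1 ≤ j ∧ j ≤ n ∧ pathHeight B j ≤ pathHeight C j :=
      ⟨n, x.2, le_rfl, hend.le⟩
    obtain ⟨hj1, hj2, hj3⟩ := Nat.find_spec hex
    have hmin : ∀ i, (x : ℕ) + 1 ≤ i → i < Nat.find hex → pathHeight C i < pathHeight B i := by
      intro i h1 h2
      by_contra hcon
      exact Nat.find_min hex h2 ⟨h1, by omega, by omega⟩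
    generalize Nat.find hex = j at *
    have hjx : (x : ℕ) + 1 < j := by
      rcases hj1.lt_or_eq with h | h
      · exact h
      · rw [← h] at hj3; omega
    obtain ⟨k, rfl⟩ : ∃ k, j = k + 1 := ⟨j - 1, by omega⟩
    obtain ⟨y, hy⟩ : ∃ y : Fin n, (y : ℕ) = k := ⟨⟨k, by omega⟩, rfl⟩
    have h1 := pathHeight_succ B y
    have h2 := pathHeight_succ C y
    have h3 := hmin k (by omega) (by omega)
    rw [hy] at h1 h2
    have hyC : y ∈ C := by
      by_contra hc
      rw [if_neg hc] at h2
      omega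
    have hyB : y ∉ B := by
      intro hc
      rw [if_pos hc] at h1
      rw [if_pos hyC] at h2
      omega
    refine ⟨y, hyC, hyB, hcard y hyB, fun i => ?_⟩
    have e := hh y hyB i
    have b := hB.2 i
    have c := hC.2 i
    have m := hmin i
    rw [hy] at e
    split_ifs at e <;> omega
  · have hex : ∃ j, j ≤ (x : ℕ) ∧ pathHeight C (x - j) ≤ pathHeight B (x - j) :=
      ⟨x, le_rfl, by simp [pathHeight_zero]⟩
    obtain ⟨hj1, hj2⟩ := Nat.find_spec hex
    have hmin : ∀ i, (x : ℕ) - Nat.find hex < i → i ≤ x → pathHeight B i < pathHeight C i := by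
      intro i h1 h2
      by_contra hcon
      refine Nat.find_min hex (m := x - i) (by omega) ⟨by omega, ?_⟩
      rw [Nat.sub_sub_self h2]
      omega
    generalize Nat.find hex = j at *
    have hj0 : 0 < j := by
      rcases Nat.eq_zero_or_pos j with h | h
      · subst h; simp only [Nat.sub_zero] at hj2; omega
      · exact h
    obtain ⟨y, hy⟩ : ∃ y : Fin n, (y : ℕ) = x - j := ⟨⟨x - j, by omega⟩, rfl⟩
    have h1 := pathHeight_succ B y
    have h2 := pathHeight_succ C y
    have h3 := hmin (x - j + 1) (by omega) (by omega)
    rw [hy] at h1 h2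
    have hyC : y ∈ C := by
      by_contra hc
      rw [if_neg hc] at h2
      omega
    have hyB : y ∉ B := by
      intro hc
      rw [if_pos hc] at h1
      rw [if_pos hyC] at h2
      omega
    refine ⟨y, hyC, hyB, hcard y hyB, fun i => ?_⟩
    have e := hh y hyB i
    have b := hB.2 i
    have c := hC.2 i
    have m := hmin i
    rw [hy] at e
    split_ifs at e <;> omega

theorem isPath_U (M : LPM n) : M.IsPath M.U := ⟨rfl, fun i => ⟨M.noncrossing i, le_rfl⟩⟩

theorem isPath_L (M : LPM n) : M.IsPath M.L := ⟨M.card_eq, fun i => ⟨le_rfl, M.noncrossing i⟩⟩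

/-- The lattice path matroid `M[U, L]` on the ground set `Fin n`: its bases are the lattice paths
inside the diagram. -/
def toMatroid (M : LPM n) : Matroid (Fin n) :=
  Matroid.ofIsBaseOfFinite (E := Set.univ) Set.finite_univ
    (fun B => ∃ F : Finset (Fin n), (F : Set (Fin n)) = B ∧ M.IsPath F)
    ⟨M.U, M.U, rfl, M.isPath_U⟩
    (by
      rintro _ _ ⟨B, rfl, hB⟩ ⟨C, rfl, hC⟩ x ⟨hxB, hxC⟩
      obtain ⟨y, hyC, hyB, hP⟩ := M.isPath_exchange hB hC hxB hxC
      exact ⟨y, ⟨hyC, hyB⟩, _, by simp, hP⟩)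
    (fun _ _ => Set.subset_univ _)

theorem toMatroid_ground (M : LPM n) : M.toMatroid.E = Set.univ := rfl

theorem toMatroid_isBase_iff (M : LPM n) (B : Finset (Fin n)) :
    M.toMatroid.IsBase (B : Set (Fin n)) ↔ M.IsPath B := by
  change (∃ F : Finset (Fin n), (F : Set (Fin n)) = B ∧ M.IsPath F) ↔ _
  simp

theorem toMatroid_injective : Function.Injective (toMatroid : LPM n → Matroid (Fin n)) := by
  intro M M' h
  have hb : ∀ B, M.IsPath B ↔ M'.IsPath B := fun B => by
    rw [← toMatroid_isBase_iff, ← toMatroid_isBase_iff, h]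
  have hU : M.U = M'.U := eq_of_pathHeight_eq fun i =>
    le_antisymm (((hb _).1 M.isPath_U).2 i).2 (((hb _).2 M'.isPath_U).2 i).2
  have hL : M.L = M'.L := eq_of_pathHeight_eq fun i =>
    le_antisymm (((hb _).2 M'.isPath_L).2 i).1 (((hb _).1 M.isPath_L).2 i).1
  cases M; cases M'
  simp only at hU hL
  subst hU hL
  rfl

/-- The poset `𝒫ₙ` of lattice path matroids on the ground set `Fin n`: `M' ≤ M` if and only if the
matroid `M'` is a quotient of the matroid `M`. -/
instance : PartialOrder (LPM n) where
  le M' M := IsMatroidQuotient M'.toMatroid M.toMatroid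
  le_refl M := .of_closure_subset M.toMatroid_ground M.toMatroid_ground fun _ => le_rfl
  le_trans M₁ M₂ M₃ h h' := .of_closure_subset M₃.toMatroid_ground M₁.toMatroid_ground
    fun X => (h'.closure_subset X).trans (h.closure_subset X)
  le_antisymm _ _ h h' := toMatroid_injective <| Matroid.ext_closure fun X =>
    (h'.closure_subset X).antisymm (h.closure_subset X)

instance : Finite (LPM n) :=
  Finite.of_injective (fun M : LPM n => (M.U, M.L)) (by
    rintro ⟨U, L, _, _⟩ ⟨U', L', _, _⟩ h
    simp only [Prod.mk.injEq] at h
    obtain ⟨rfl, rfl⟩ := h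
    rfl)

/-- `(l, u)` is a good pair of `M = M[U, L]`: `l` is the `i`-th smallest element of `L` and `u` the
`j`-th smallest element of `U`, where `i ≤ j` and `u - l ≤ j - i`. -/
def IsGoodPair (M : LPM n) (l u : Fin n) : Prop :=
  l ∈ M.L ∧ u ∈ M.U ∧
    pathHeight M.L (l + 1) ≤ pathHeight M.U (u + 1) ∧
    ((u : ℤ) - (l : ℤ) ≤ (pathHeight M.U (u + 1) : ℤ) - (pathHeight M.L (l + 1) : ℤ))

end LPM

/-! ## Edge labelings of posets -/

/-- An edge labeling of `P`: a map to `Λ` from the edges `x ⋖ y` of the Hasse diagram of `P`. -/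
abbrev EdgeLabeling (P Λ : Type*) [PartialOrder P] : Type _ :=
  ∀ ⦃x y : P⦄, x ⋖ y → Λ

/-- Saturated chains `x₀ ⋖ x₁ ⋖ ⋯ ⋖ x_k` of `P`. -/
abbrev SaturatedChain (P : Type*) [PartialOrder P] : Type _ :=
  RelSeries {(x, y) : P × P | x ⋖ y}

/-- `c` is a maximal chain of the interval `[x, y]`: a saturated chain from `x` to `y`. -/
def SaturatedChain.FromTo {P : Type*} [PartialOrder P] (c : SaturatedChain P) (x y : P) : Prop :=
  c.head = x ∧ c.last = y

namespace EdgeLabeling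

variable {P Λ : Type*} [PartialOrder P]

/-- The word of labels of a saturated chain, read from the bottom to the top. -/
def word (lab : EdgeLabeling P Λ) (c : SaturatedChain P) : List Λ :=
  List.ofFn fun i : Fin c.length => lab (c.step i)

variable [PartialOrder Λ]

/-- The labels of `c` increase strictly. -/
def Increasing (lab : EdgeLabeling P Λ) (c : SaturatedChain P) : Prop :=
  (lab.word c).IsChain (· < ·)

/-- The labels of `c` increase weakly. -/
def WeaklyIncreasing (lab : EdgeLabeling P Λ) (c : SaturatedChain P) : Prop :=
  (lab.word c).IsChain (· ≤ ·)

/-- `c` is a falling (ascent-free) chain: no label is smaller than the next one. -/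
def Falling (lab : EdgeLabeling P Λ) (c : SaturatedChain P) : Prop :=
  (lab.word c).IsChain (fun a b => ¬ a < b)

/-- Each closed interval has a unique increasing maximal chain. -/
def IsER (lab : EdgeLabeling P Λ) : Prop :=
  ∀ x y : P, x ≤ y → ∃! c : SaturatedChain P, c.FromTo x y ∧ lab.Increasing c

/-- The rank two switching property: whenever `x ⋖ y ⋖ z` is an ascending step, there is a unique
`y'` such that `x ⋖ y' ⋖ z` carries the same two labels in the opposite order. (The other elements
of a maximal chain through `x ⋖ y ⋖ z` play no role here.) -/
def RankTwoSwitching (lab : EdgeLabeling P Λ) : Prop :=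
  ∀ ⦃x y z : P⦄ (hxy : x ⋖ y) (hyz : y ⋖ z), lab hxy < lab hyz →
    ∃! y' : P, ∃ (hx : x ⋖ y') (hz : y' ⋖ z), lab hx = lab hyz ∧ lab hz = lab hxy

/-- In each closed interval, distinct falling maximal chains have distinct words of labels. -/
def FallingWordsUnique (lab : EdgeLabeling P Λ) : Prop :=
  ∀ (x y : P) (c c' : SaturatedChain P), c.FromTo x y → c'.FromTo x y →
    lab.Falling c → lab.Falling c' → lab.word c = lab.word c' → c = c'

/-- EW-labelings. -/
structure IsEW (lab : EdgeLabeling P Λ) : Prop where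
  isER : lab.IsER
  rankTwoSwitching : lab.RankTwoSwitching
  fallingWordsUnique : lab.FallingWordsUnique

end EdgeLabeling

/-- The label poset `[n] × [n]`, with `(u', l') ≤ (u, l)` if and only if `u ≤ u'` and `l ≤ l'`. -/
abbrev LabelPoset (n : ℕ) : Type := (Fin n × Fin n)ᵒᵈ

/-- `lab` is the good pair labeling of `𝒫ₙ`: the cover of `M' = M[U', L']` by `M = M[U, L]` is
labeled `(u, l)`, where `U \ U' = {u}`, `L \ L' = {l}`, and `(l, u)` is a good pair of `M`. At most
one labeling satisfies this. -/
def IsGoodPairLabeling {n : ℕ} (lab : EdgeLabeling (LPM n) (LabelPoset n)) : Prop :=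
  ∀ ⦃M' M : LPM n⦄ (h : M' ⋖ M),
    M'.U ⊆ M.U ∧ M.U \ M'.U = {(OrderDual.ofDual (lab h)).1} ∧
    M'.L ⊆ M.L ∧ M.L \ M'.L = {(OrderDual.ofDual (lab h)).2} ∧
    M.IsGoodPair (OrderDual.ofDual (lab h)).2 (OrderDual.ofDual (lab h)).1

/-! ## Whitney duality -/

/-- `ρ` is a rank function of the poset `P`. -/
structure IsRankFunction {P : Type*} [PartialOrder P] (ρ : P → ℕ) : Prop where
  strictMono : StrictMono ρ
  isMin : ∀ x, IsMin x → ρ x = 0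
  covBy : ∀ x y, x ⋖ y → ρ y = ρ x + 1

open Classical in
/-- The Möbius function of a finite poset. -/
noncomputable def moebius (P : Type*) [PartialOrder P] [Finite P] (x y : P) : ℤ :=
  letI : Fintype P := Fintype.ofFinite P
  letI : LocallyFiniteOrder P := Fintype.toLocallyFiniteOrder
  IncidenceAlgebra.mu ℤ x y

/-- The `k`-th Whitney number of the second kind: the number of elements of rank `k`. -/
noncomputable def whitneySecond {P : Type*} (ρ : P → ℕ) (k : ℕ) : ℕ :=
  {x : P | ρ x = k}.ncard

/-- The `k`-th Whitney number of the first kind: the sum of `μ(z, x)` over the elements `x` of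
rank `k`, where `z` is the minimum. -/
noncomputable def whitneyFirst {P : Type*} [PartialOrder P] [Finite P] (ρ : P → ℕ) (z : P)
    (k : ℕ) : ℤ :=
  ∑ᶠ (x : P) (_ : ρ x = k), moebius P z x

/-- `Q` is a Whitney dual of `P`: both are ranked with a minimum, and up to sign the Whitney numbers
of the first and of the second kind are exchanged. -/
def IsWhitneyDual (Q P : Type*) [PartialOrder Q] [Finite Q] [PartialOrder P] [Finite P] : Prop :=
  ∃ (ρQ : Q → ℕ) (ρP : P → ℕ) (zQ : Q) (zP : P),
    IsRankFunction ρQ ∧ IsRankFunction ρP ∧ IsBot zQ ∧ IsBot zP ∧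
    ∀ k, (whitneySecond ρQ k : ℤ) = |whitneyFirst ρP zP k| ∧
      |whitneyFirst ρQ zQ k| = (whitneySecond ρP k : ℤ)

/-! ## Heights of lattice paths -/

/-! The quotient order has a description by diagrams, `LPM.Dominates`: `M' ≤ M` holds exactly when
`M'` arises by deleting north steps from both paths of `M` in such a way that the deleted steps,
paired off in increasing order, are good pairs of `M`. Necessity (`dominates_of_le`) compares
closures of initial and final segments and then tests the quotient on extremal paths. Sufficiency
goes one good pair at a time: `le_of_erase` compares closures by exchanging a segment between a path
of `M'` and a path of `M`, and the two good pair inequalities guarantee a segment that can be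
exchanged. Deleting the smallest pair first leaves a diagram that still dominates `M'`. Hence covers
are deletions of single good pairs, and the rank is `|U|`.

The labels of a chain from `M'` to `M` spell `U \ U'` in their first and `L \ L'` in their second
coordinates. In a weakly increasing word both coordinates are sorted, so the interval determines the
word; the top and the word determine the chain. Deleting the smallest pair first gives existence.
Two labels comparable in both coordinates can be switched because deleting the smaller pair shifts
both heights at the larger pair by one.

The Whitney dual is built directly. Only crossing labels affect the difference of the two heights
that decides whether a label is good, so a class of chains under switching is a `Heap`. A heap
without crossings has Möbius value `(-1)^rank`, every other heap has value 0, and the heaps without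
crossings correspond to the lattice path matroids. Conversely, `μ(0, M)` is the signed number of
heaps over `M`: a heap over some `M' ≤ M` is the same as a heap over `M` from which a set of top
labels has been removed, and the alternating sum over these sets cancels (`sum_heap_le`). -/

section Heights

variable {n : ℕ} (C B : Finset (Fin n))

theorem pathHeight_le_succ (i : ℕ) : pathHeight B i ≤ pathHeight B (i + 1) :=
  Finset.card_le_card fun x hx => by
    simp only [Finset.mem_filter] at hx ⊢
    exact ⟨hx.1, by omega⟩

theorem pathHeight_succ_of_le {i : ℕ} (h : n ≤ i) : pathHeight B (i + 1) = pathHeight B i := by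
  unfold pathHeight
  congr 1
  ext x
  have := x.2
  simp only [Finset.mem_filter, and_congr_right_iff]
  intro _
  omega

theorem pathHeight_succ_le (i : ℕ) : pathHeight B (i + 1) ≤ pathHeight B i + 1 := by
  by_cases h : i < n
  · have := pathHeight_succ B ⟨i, h⟩
    simp only at this
    rw [this]
    split_ifs <;> omega
  · rw [pathHeight_succ_of_le B (by omega)]
    omega

theorem pathHeight_mono : Monotone (pathHeight B) :=
  monotone_nat_of_le_succ (pathHeight_le_succ B)

theorem pathHeight_le_add {i j : ℕ} (h : i ≤ j) : pathHeight B j + i ≤ pathHeight B i + j := by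
  induction j, h using Nat.le_induction with
  | base => exact le_rfl
  | succ j _ ih => have := pathHeight_succ_le B j; omega

theorem pathHeight_of_le {i : ℕ} (h : n ≤ i) : pathHeight B i = B.card := by
  rw [pathHeight, Finset.filter_true_of_mem]
  intro x _
  exact lt_of_lt_of_le x.2 h

theorem pathHeight_succ_of_mem {B : Finset (Fin n)} {x : Fin n} (h : x ∈ B) :
    pathHeight B (x + 1) = pathHeight B x + 1 := by
  rw [pathHeight_succ, if_pos h]

theorem pathHeight_succ_of_notMem {B : Finset (Fin n)} {x : Fin n} (h : x ∉ B) :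
    pathHeight B (x + 1) = pathHeight B x := by
  rw [pathHeight_succ, if_neg h, add_zero]

theorem pathHeight_lt_card {B : Finset (Fin n)} {x : Fin n} (h : x ∈ B) :
    pathHeight B x < B.card := by
  rw [← pathHeight_end]
  have h1 := pathHeight_mono B (show (x : ℕ) + 1 ≤ n from x.2)
  rw [pathHeight_succ_of_mem h] at h1
  omega

theorem pathHeight_lt_of_mem {B : Finset (Fin n)} {x : Fin n} (h : x ∈ B) {i : ℕ}
    (hi : (x : ℕ) < i) :
    pathHeight B x < pathHeight B i := by
  have h1 := pathHeight_mono B (show (x : ℕ) + 1 ≤ i from hi)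
  rw [pathHeight_succ_of_mem h] at h1
  omega

/-- For `x ∈ B` the number `pathHeight B x` is the zero-based position of `x` in `B`. "The k-th
smallest element" is expressed in this way throughout. -/
theorem pathHeight_injOn {B : Finset (Fin n)} {x y : Fin n} (hx : x ∈ B) (hy : y ∈ B)
    (h : pathHeight B x = pathHeight B y) : x = y := by
  rcases lt_trichotomy (x : ℕ) y with h1 | h1 | h1
  · have := pathHeight_lt_of_mem hx h1; omega
  · exact Fin.ext h1
  · have := pathHeight_lt_of_mem hy h1; omega

theorem exists_pathHeight_eq {B : Finset (Fin n)} {k : ℕ} (h : k < B.card) :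
    ∃ x ∈ B, pathHeight B x = k := by
  have hinj : Set.InjOn (fun x : Fin n => pathHeight B x) B := fun x hx y hy hxy =>
    pathHeight_injOn hx hy hxy
  have := Finset.eq_of_subset_of_card_le (s := B.image fun x : Fin n => pathHeight B x)
    (t := Finset.range B.card) (fun i hi => by
      obtain ⟨x, hx, rfl⟩ := Finset.mem_image.1 hi
      exact Finset.mem_range.2 (pathHeight_lt_card hx))
    (by rw [Finset.card_image_of_injOn hinj, Finset.card_range])
  have hk : k ∈ B.image fun x : Fin n => pathHeight B x := this ▸ Finset.mem_range.2 h
  exact Finset.mem_image.1 hk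

theorem pathHeight_erase {B : Finset (Fin n)} {x : Fin n} (hx : x ∈ B) (i : ℕ) :
    pathHeight B i = pathHeight (B.erase x) i + if (x : ℕ) < i then 1 else 0 := by
  rw [← pathHeight_insert _ (by simp), Finset.insert_erase hx]

theorem pathHeight_sdiff {B C : Finset (Fin n)} (h : C ⊆ B) (i : ℕ) :
    pathHeight (B \ C) i + pathHeight C i = pathHeight B i := by
  unfold pathHeight
  rw [← Finset.card_union_of_disjoint]
  · rw [← Finset.filter_union, Finset.sdiff_union_of_subset h]
  · exact Finset.disjoint_filter_filter Finset.sdiff_disjoint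

/-- Every function with steps `0` and `1` is the height function of a path. -/
theorem exists_pathHeight (g : ℕ → ℕ) (h0 : g 0 = 0) (h1 : ∀ i, g i ≤ g (i + 1))
    (h2 : ∀ i, g (i + 1) ≤ g i + 1) : ∃ B : Finset (Fin n), ∀ i ≤ n, pathHeight B i = g i := by
  refine ⟨Finset.univ.filter fun x : Fin n => g x < g (x + 1), fun i => ?_⟩
  induction i with
  | zero => intro _; rw [pathHeight_zero, h0]
  | succ i ih =>
    intro hi
    have e := pathHeight_succ (Finset.univ.filter fun x : Fin n => g x < g (x + 1)) ⟨i, hi⟩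
    simp only [Finset.mem_filter, Finset.mem_univ, true_and] at e
    rw [e, ih (by omega)]
    have := h1 i
    have := h2 i
    split_ifs <;> omega

/-- Follow `B` in the window `[s, t)` and `C` elsewhere. -/
def splice (C B : Finset (Fin n)) (s t : ℕ) : Finset (Fin n) :=
  Finset.univ.filter fun x : Fin n => if s ≤ x ∧ (x : ℕ) < t then x ∈ B else x ∈ C

theorem mem_splice_of_window {s t : ℕ} {x : Fin n} (h : s ≤ x ∧ (x : ℕ) < t) :
    x ∈ splice C B s t ↔ x ∈ B := by
  simp [splice, h]

theorem mem_splice_of_not_window {s t : ℕ} {x : Fin n} (h : ¬ (s ≤ x ∧ (x : ℕ) < t)) :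
    x ∈ splice C B s t ↔ x ∈ C := by
  simp [splice, h]

/-- The paths differ by the same `c` at both ends of the window, so the translate of `B` by `c` fits
into the gap in `C`. The exchanged steps are those in `[s, t)`, but the heights are known on the
closed interval `[s, t]`. -/
theorem pathHeight_splice {s t : ℕ} {c : ℤ} (hst : s ≤ t)
    (hs : (pathHeight C s : ℤ) = pathHeight B s + c)
    (ht : (pathHeight C t : ℤ) = pathHeight B t + c) (i : ℕ) :
    (pathHeight (splice C B s t) i : ℤ) =
      if s ≤ i ∧ i ≤ t then pathHeight B i + c else (pathHeight C i : ℤ) := by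
  induction i with
  | zero =>
    simp only [pathHeight_zero] at *
    split_ifs with h
    · obtain rfl : s = 0 := by omega
      simpa [pathHeight_zero] using hs
    · rfl
  | succ i ih =>
    by_cases hi : i < n
    · have e1 := pathHeight_succ (splice C B s t) ⟨i, hi⟩
      have e2 := pathHeight_succ C ⟨i, hi⟩
      have e3 := pathHeight_succ B ⟨i, hi⟩
      simp only at e1 e2 e3
      by_cases h : s ≤ i ∧ i < t
      · have hm := mem_splice_of_window C B (x := ⟨i, hi⟩) h
        simp only [hm] at e1
        rw [if_pos (by omega)] at ih ⊢
        omega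
      · have hm := mem_splice_of_not_window C B (x := ⟨i, hi⟩) h
        simp only [hm] at e1
        by_cases h1 : s = i + 1
        · subst h1
          rw [if_neg (by omega)] at ih
          rw [if_pos (by omega)]
          omega
        rw [if_neg (c := s ≤ i + 1 ∧ i + 1 ≤ t) (by omega)]
        by_cases h2 : s ≤ i ∧ i = t
        · obtain ⟨-, rfl⟩ := h2
          rw [if_pos (by omega)] at ih
          omega
        · rw [if_neg (by omega)] at ih
          omega
    · rw [pathHeight_succ_of_le _ (by omega), pathHeight_succ_of_le B (by omega),
        pathHeight_succ_of_le C (by omega), ih]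
      by_cases h1 : s = i + 1
      · subst h1
        rw [pathHeight_succ_of_le B (by omega), pathHeight_succ_of_le C (by omega)] at hs
        split_ifs <;> omega
      by_cases h2 : i = t
      · subst h2
        split_ifs <;> omega
      · split_ifs <;> omega

/-- An exchange only trades steps between the two paths. Hence if both paths meet `X` maximally, so
do both results. -/
theorem card_filter_splice (X : Set (Fin n)) [DecidablePred (· ∈ X)] (s t : ℕ) :
    ((splice C B s t).filter (· ∈ X)).card + ((splice B C s t).filter (· ∈ X)).card =
      (C.filter (· ∈ X)).card + (B.filter (· ∈ X)).card := by
  have key : ∀ A : Finset (Fin n), (A.filter (· ∈ X)).card =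
      ∑ x, if x ∈ A ∧ x ∈ X then 1 else 0 := fun A => by
    rw [← Finset.card_filter]
    congr 1
    ext; simp
  simp only [key, ← Finset.sum_add_distrib, splice, Finset.mem_filter, Finset.mem_univ, true_and]
  refine Finset.sum_congr rfl fun x _ => ?_
  by_cases h : s ≤ x ∧ (x : ℕ) < t
  · simp only [h, and_self, if_true]; exact add_comm _ _
  · simp only [h, if_false]

end Heights

/-! ## Discrete intermediate values -/

/-- A function that climbs by at most one per step cannot jump over `c`; the point found is the last
one up to `x` with value `c`. The companion `exists_first_eq` is its mirror image under `i ↦ m - i`.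
-/
theorem exists_last_eq {f : ℕ → ℤ} (hf : ∀ i, f (i + 1) ≤ f i + 1) {c : ℤ} (h0 : f 0 ≤ c) {x : ℕ}
    (hx : c ≤ f x) : ∃ s ≤ x, f s = c ∧ ∀ i, s ≤ i → i ≤ x → c ≤ f i := by
  induction x with
  | zero =>
    refine ⟨0, le_rfl, by omega, fun i _ hi => ?_⟩
    obtain rfl : i = 0 := by omega
    exact hx
  | succ x ih =>
    rcases hx.eq_or_lt with h | h
    · refine ⟨x + 1, le_rfl, h.symm, fun i h1 h2 => ?_⟩
      obtain rfl : i = x + 1 := by omega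
      exact hx
    · have := hf x
      obtain ⟨s, hs, h1, h2⟩ := ih (by omega)
      refine ⟨s, by omega, h1, fun i h3 h4 => ?_⟩
      rcases Nat.lt_or_ge x i with h5 | h5
      · obtain rfl : i = x + 1 := by omega
        exact hx
      · exact h2 i h3 h5

theorem exists_first_eq {f : ℕ → ℤ} (hf : ∀ i, f i ≤ f (i + 1) + 1) {c : ℤ} {x m : ℕ}
    (hxm : x ≤ m) (hm : f m ≤ c) (hx : c ≤ f x) :
    ∃ t, x ≤ t ∧ t ≤ m ∧ f t = c ∧ ∀ i, x ≤ i → i ≤ t → c ≤ f i := by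
  obtain ⟨s, hs, h1, h2⟩ := exists_last_eq (f := fun i => f (m - i)) (c := c) (x := m - x)
    (fun i => by
      rcases Nat.lt_or_ge i m with h | h
      · have := hf (m - (i + 1))
        rwa [show m - (i + 1) + 1 = m - i by omega] at this
      · simp only [show m - (i + 1) = 0 by omega, show m - i = 0 by omega]
        omega) (by simpa using hm) (by rwa [Nat.sub_sub_self hxm])
  refine ⟨m - s, by omega, by omega, h1, fun i h3 h4 => ?_⟩
  have := h2 (m - i) (by omega) (by omega)
  rwa [show m - (m - i) = i by omega] at this

/-! ### Closures in lattice path matroids, and the removal of one good pair -/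

namespace LPM

variable {n : ℕ}

theorem exists_isPath_of_isBase (M : LPM n) {B : Set (Fin n)} (h : M.toMatroid.IsBase B) :
    ∃ F : Finset (Fin n), (F : Set (Fin n)) = B ∧ M.IsPath F := by
  classical
  have := Set.toFinite B
  refine ⟨this.toFinset, by simp, ?_⟩
  rw [← toMatroid_isBase_iff]
  simpa using h

/-- An element is outside the closure of `X` iff it lies in a base that meets `X` in as many
elements as possible. -/
theorem notMem_closure_iff (M : LPM n) (X : Set (Fin n)) [DecidablePred (· ∈ X)] (x : Fin n) :
    x ∉ M.toMatroid.closure X ↔ ∃ B, M.IsPath B ∧ x ∈ B ∧ x ∉ X ∧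
      ∀ C, M.IsPath C → (C.filter (· ∈ X)).card ≤ (B.filter (· ∈ X)).card := by
  have hE : ∀ Y : Set (Fin n), Y ⊆ M.toMatroid.E := fun Y => by simp [toMatroid_ground]
  have hcoe : ∀ C : Finset (Fin n), ((C.filter (· ∈ X) : Finset _) : Set (Fin n)) = ↑C ∩ X := by
    intro C; ext; simp
  constructor
  · intro hx
    obtain ⟨I, hI⟩ := M.toMatroid.exists_isBasis X (hE X)
    have hxI : x ∉ M.toMatroid.closure I := by rwa [hI.closure_eq_closure]
    obtain ⟨B', hB', hIB⟩ :=
      ((hI.indep.notMem_closure_iff (hE Set.univ trivial)).1 hxI).1.exists_isBase_superset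
    obtain ⟨B, rfl, hB⟩ := M.exists_isPath_of_isBase hB'
    refine ⟨B, hB, by simpa using hIB (Set.mem_insert x I),
      fun h => hx (M.toMatroid.subset_closure X (hE X) h), fun C hC => ?_⟩
    have hIX : I ⊆ (B.filter (· ∈ X) : Finset _) := by
      rw [hcoe]
      exact Set.subset_inter ((Set.subset_insert x I).trans hIB) hI.subset
    have hCi : M.toMatroid.Indep (C.filter (· ∈ X) : Finset _) := by
      refine ((M.toMatroid_isBase_iff C).2 hC).indep.subset ?_
      exact Finset.coe_subset.2 (Finset.filter_subset _ _)
    have h1 := hCi.eRk_eq_encard.symm.le.trans (M.toMatroid.eRk_mono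
      (show ((C.filter (· ∈ X) : Finset _) : Set (Fin n)) ⊆ X by rw [hcoe]; simp))
    rw [← hI.encard_eq_eRk] at h1
    have h2 := h1.trans (Set.encard_le_encard hIX)
    rw [Set.encard_coe_eq_coe_finsetCard, Set.encard_coe_eq_coe_finsetCard] at h2
    exact_mod_cast h2
  · rintro ⟨B, hB, hxB, hxX, hmax⟩ hx
    have hBi := ((M.toMatroid_isBase_iff B).2 hB).indep
    have hBX : M.toMatroid.Indep (B.filter (· ∈ X) : Finset _) := 
      hBi.subset (Finset.coe_subset.2 (Finset.filter_subset _ _))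
    -- By maximality `B ∩ X` is already a basis of `X`, so the closure of `X` is that of `B ∩ X`, a
    -- subset of `B \ {x}`.
    obtain ⟨J, hJ, hBJ⟩ := hBX.subset_isBasis_of_subset (X := X) (by rw [hcoe]; simp)
    obtain ⟨C', hC', rfl⟩ := hJ.exists_isBase
    obtain ⟨C, rfl, hC⟩ := M.exists_isPath_of_isBase hC'
    rw [← hcoe] at hJ hBJ
    have heq := Finset.eq_of_subset_of_card_le (by exact_mod_cast hBJ) (hmax C hC)
    rw [← heq] at hJ
    rw [← hJ.closure_eq_closure] at hx
    refine hBi.notMem_closure_sdiff_of_mem (by simpa using hxB)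
      (M.toMatroid.closure_subset_closure ?_ hx)
    rw [hcoe]
    rintro y ⟨hy1, hy2⟩
    exact ⟨hy1, fun h => hxX (h ▸ hy2)⟩

/-- Closures grow under a quotient, so independent sets of `M'` are independent in `M`. Dually,
spanning sets of `M` span `M'`, which gives `exists_isPath_subset_of_le`. -/
theorem exists_isPath_superset_of_le {M' M : LPM n} (h : M' ≤ M) {B : Finset (Fin n)}
    (hB : M'.IsPath B) : ∃ C, M.IsPath C ∧ B ⊆ C := by
  have hi : M.toMatroid.Indep B := by
    rw [Matroid.indep_iff_forall_notMem_closure_sdiff (by simp [toMatroid_ground])]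
    intro e he hc
    exact ((M'.toMatroid_isBase_iff B).2 hB).indep.notMem_closure_sdiff_of_mem he
      (IsMatroidQuotient.closure_subset h _ hc)
  obtain ⟨C', hC', hBC⟩ := hi.exists_isBase_superset
  obtain ⟨C, rfl, hC⟩ := M.exists_isPath_of_isBase hC'
  exact ⟨C, hC, by exact_mod_cast hBC⟩

theorem exists_isPath_subset_of_le {M' M : LPM n} (h : M' ≤ M) {C : Finset (Fin n)}
    (hC : M.IsPath C) : ∃ B, M'.IsPath B ∧ B ⊆ C := by
  have hs : M'.toMatroid.Spanning C := by
    rw [Matroid.spanning_iff_ground_subset_closure (by simp [toMatroid_ground])]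
    have := IsMatroidQuotient.closure_subset h (C : Set (Fin n))
    rwa [((M.toMatroid_isBase_iff C).2 hC).closure_eq] at this
  obtain ⟨B', hB', hBC⟩ := hs.exists_isBase_subset
  obtain ⟨B, rfl, hB⟩ := M'.exists_isPath_of_isBase hB'
  exact ⟨B, hB, by exact_mod_cast hBC⟩

/-! ### Removing a good pair -/

theorem isGoodPair_iff (M : LPM n) (l u : Fin n) : M.IsGoodPair l u ↔ l ∈ M.L ∧ u ∈ M.U ∧
    pathHeight M.L l ≤ pathHeight M.U u ∧
    ((u : ℤ) - l ≤ (pathHeight M.U u : ℤ) - pathHeight M.L l) := by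
  unfold IsGoodPair
  refine and_congr_right fun hl => and_congr_right fun hu => ?_
  rw [pathHeight_succ_of_mem hl, pathHeight_succ_of_mem hu]
  push_cast
  omega

/-- The lattice path matroid obtained by removing a good pair. -/
def erasePair (M : LPM n) (l u : Fin n) (h : M.IsGoodPair l u) : LPM n where
  U := M.U.erase u
  L := M.L.erase l
  card_eq := by rw [Finset.card_erase_of_mem h.1, Finset.card_erase_of_mem h.2.1, M.card_eq]
  noncrossing i := by
    obtain ⟨hl, hu, h1, -⟩ := (M.isGoodPair_iff l u).1 h
    have e1 := pathHeight_erase hl i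
    have e2 := pathHeight_erase hu i
    have := M.noncrossing i
    by_cases h2 : (u : ℕ) < i
    · by_cases h3 : (l : ℕ) < i
      · simp only [h2, h3, if_true] at e1 e2
        omega
      -- Only for `u < i ≤ l` does the upper path drop while the lower one stays. There the height
      -- of `L` is at most its height at `l`, hence at most that of `U` at `u`, which is less than
      -- that of `U` at `i`.
      · have h4 := pathHeight_lt_of_mem hu h2
        have h5 := pathHeight_mono M.L (show i ≤ l by omega)
        simp only [h2, h3, if_true, if_false] at e1 e2
        omega
    · simp only [h2, if_false] at e2
      omega

/-- The window in which two paths can be exchanged, for the removal of a good pair. -/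
theorem exists_exchange_window {M' M : LPM n} {l u : Fin n} (h : M.IsGoodPair l u)
    (hU : M'.U = M.U.erase u) (hL : M'.L = M.L.erase l) {B C : Finset (Fin n)}
    (hB : M'.IsPath B) (hC : M.IsPath C) {x : Fin n} (hxB : x ∈ B) (hxC : x ∉ C) :
    ∃ (s t : ℕ) (c : ℤ), s ≤ x ∧ (x : ℕ) < t ∧
      (pathHeight C s : ℤ) = pathHeight B s + c ∧ (pathHeight C t : ℤ) = pathHeight B t + c ∧
      ∀ i, s ≤ i → i ≤ t →
        (pathHeight M.L i : ℤ) ≤ pathHeight B i + c ∧ pathHeight B i + c ≤ pathHeight M.U i ∧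
        (pathHeight M'.L i : ℤ) ≤ pathHeight C i - c ∧
        (pathHeight C i : ℤ) - c ≤ pathHeight M'.U i := by
  obtain ⟨hl, hu, hg1, hg2⟩ := (M.isGoodPair_iff l u).1 h
  have hU' := fun i => pathHeight_erase hu i
  have hL' := fun i => pathHeight_erase hl i
  rw [← hU] at hU'
  rw [← hL] at hL'
  have hBi := hB.2
  have hCi := hC.2
  have hxB' := pathHeight_succ_of_mem hxB
  have hxC' := pathHeight_succ_of_notMem hxC
  -- The exchange needs a window around `x` with `δ = c` at both ends, where `c` is 0 or 1. Since
  -- `δ` runs from 0 to 1 and drops by one at `x`, the cases are `δ x ≤ 0`, `δ x = 1` and `δ x ≥ 2`.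
  -- In the outer cases `δ ≤ 0`, respectively `δ ≥ 1`, on the whole window, and the bounds are
  -- immediate.
  set δ : ℕ → ℤ := fun i => pathHeight C i - pathHeight B i with hδ
  have hδ1 : ∀ i, δ (i + 1) ≤ δ i + 1 := fun i => by
    have := pathHeight_succ_le C i
    have := pathHeight_le_succ B i
    simp only [hδ]; omega
  have hδ2 : ∀ i, δ i ≤ δ (i + 1) + 1 := fun i => by
    have := pathHeight_le_succ C i
    have := pathHeight_succ_le B i
    simp only [hδ]; omega
  have hδ0 : δ 0 = 0 := by simp [hδ, pathHeight_zero]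
  have hδn : δ n = 1 := by
    have := Finset.card_erase_add_one hu
    simp only [hδ, pathHeight_end, hB.1, hC.1, hU]
    omega
  have hδx : δ (x + 1) = δ x - 1 := by simp only [hδ]; omega
  have hxn : (x : ℕ) + 1 ≤ n := x.2
  rcases lt_or_ge (δ x) 1 with h1 | h1
  · obtain ⟨s, hs, hs1, hs2⟩ := exists_last_eq (f := fun i => - δ i) (c := 0) (x := x)
      (fun i => by have := hδ2 i; omega) (by simp [hδ0]) (by omega)
    obtain ⟨t, ht, -, ht1, ht2⟩ := exists_first_eq (f := fun i => - δ i) (c := 0) (x := x + 1)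
      (m := n) (fun i => by have := hδ1 i; omega) hxn (by omega) (by omega)
    refine ⟨s, t, 0, hs, ht, by simp only [hδ] at hs1; omega, by simp only [hδ] at ht1; omega,
      fun i h2 h3 => ?_⟩
    have h4 : δ i ≤ 0 := by
      rcases Nat.lt_or_ge x i with h5 | h5
      · have := ht2 i h5 h3; omega
      · have := hs2 i h2 h5; omega
    simp only [hδ] at h4
    have := hBi i
    have := hCi i
    have e1 := hU' i
    have e2 := hL' i
    split_ifs at e1 e2 <;> omega
  rcases lt_or_ge (δ x) 2 with h2 | h2
  -- Here `δ` drops from 1 to 0: either a window with `c = 0` ends at `x + 1`, or one with `c = 1`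
  -- starts at `x`. The good pair is used to show that if the former is obstructed, the latter is
  -- not.
  · by_cases hA : ∃ s, s ≤ (x : ℕ) ∧ δ s = 0 ∧ ∀ i, s ≤ i → i ≤ x + 1 →
        pathHeight M.L i ≤ pathHeight B i ∧ pathHeight C i ≤ pathHeight M'.U i
    · obtain ⟨s, hs, hs1, hs2⟩ := hA
      refine ⟨s, x + 1, 0, hs, by omega, by simp only [hδ] at hs1; omega,
        by simp only [hδ] at hδx h1 h2; omega, fun i h3 h4 => ?_⟩
      have := hs2 i h3 h4
      have := hBi i
      have := hCi i
      have e1 := hU' i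
      have e2 := hL' i
      split_ifs at e1 e2 <;> omega
    obtain ⟨s, hs, hs1, hs2⟩ := exists_last_eq (f := δ) (c := 0) (x := x) hδ1 hδ0.le (by omega)
    obtain ⟨p, hsp, hpx, hp⟩ : ∃ p, s ≤ p ∧ p ≤ x + 1 ∧
        (pathHeight B p < pathHeight M.L p ∨ pathHeight M'.U p < pathHeight C p) := by
      by_contra! hcon
      exact hA ⟨s, hs, hs1, hcon⟩
    have hsp' : pathHeight B p ≤ pathHeight C p := by
      rcases Nat.lt_or_ge x p with h5 | h5
      · obtain rfl : p = x + 1 := by omega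
        simp only [hδ] at hδx h1; omega
      · have := hs2 p hsp h5; simp only [hδ] at this; omega
    obtain ⟨t, ht, -, ht1, ht2⟩ := exists_first_eq (f := fun i => - δ i) (c := -1) (x := x + 1)
      (m := n) (fun i => by have := hδ1 i; omega) hxn (by omega) (by omega)
    refine ⟨x, t, 1, le_rfl, ht, by simp only [hδ] at h1 h2; omega,
      by simp only [hδ] at ht1; omega, fun q h3 h4 => ?_⟩
    have hq : pathHeight C q ≤ pathHeight B q + 1 := by
      rcases Nat.lt_or_ge x q with h5 | h5
      · have := ht2 q h5 h4; simp only [hδ] at this; omega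
      · obtain rfl : q = x := by omega
        simp only [hδ] at h1 h2; omega
    have b1 := hBi p
    have c1 := hCi p
    have b2 := hBi q
    have c2 := hCi q
    have u1 := hU' p
    have l1 := hL' p
    have u2 := hU' q
    have l2 := hL' q
    suffices hh : (pathHeight M.L q ≤ pathHeight B q + 1 ∧ pathHeight B q + 1 ≤ pathHeight M.U q) ∧
        pathHeight M'.L q + 1 ≤ pathHeight C q ∧ pathHeight C q ≤ pathHeight M'.U q + 1 by omega
    have hBs := pathHeight_succ_of_mem hxB
    have hLl := pathHeight_succ_of_mem hl
    have hUu := pathHeight_succ_of_mem hu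
    have hxq : q = x ∧ p = x + 1 ∨ p ≤ q := by omega
    have hδx' : pathHeight C x = pathHeight B x + 1 := by simp only [hδ] at h1 h2; omega
    have hBx := hBi x
    have hCx := hCi x
    have hLx := hL' x
    have hUx := hU' x
    -- An obstruction at `p` means that `B` is below `L` (so `l < p`) or `C` above `U'` (so `u <
    -- p`). One at `q` means that `B` touches `U` (so `q ≤ u`) or `C` touches `L` (so `q ≤ l`). For
    -- `p ≤ q`, the pair (`B` below `L`, `B` touches `U`) contradicts `u - l ≤ j - i`, and the pair
    -- (`C` above `U'`, `C` touches `L`) contradicts `i ≤ j`. The mixed pairs leave only `q = x`, `p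
    -- = x + 1`.
    refine ⟨⟨by split_ifs at l2 <;> omega, ?_⟩, ?_, by split_ifs at u2 <;> omega⟩
    · by_contra hcon
      have hqu : q ≤ u := by by_contra hc; rw [if_pos (by omega)] at u2; omega
      rcases hp with hp | hp
      · have hlp : (l : ℕ) < p := by by_contra hc; rw [if_neg hc] at l1; omega
        have k1 := pathHeight_le_add M.U hqu
        have k2 := pathHeight_le_add M.L (show (l : ℕ) + 1 ≤ p from hlp)
        rw [if_pos hlp] at l1
        rcases hxq with ⟨rfl, rfl⟩ | hpq
        · omega
        · have k3 := pathHeight_le_add B hpq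
          omega
      · have hup : (u : ℕ) < p := by by_contra hc; rw [if_neg hc] at u1; omega
        rw [if_pos hup] at u1
        obtain ⟨rfl, rfl⟩ : q = x ∧ p = x + 1 := by omega
        have hux : (u : ℕ) = x := by omega
        rw [hux] at hUu
        omega
    · by_contra hcon
      have hql : q ≤ l := by by_contra hc; rw [if_pos (by omega)] at l2; omega
      rcases hp with hp | hp
      · have hlp : (l : ℕ) < p := by by_contra hc; rw [if_neg hc] at l1; omega
        obtain ⟨rfl, rfl⟩ : q = x ∧ p = x + 1 := by omega
        rw [if_neg (by omega)] at hLx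
        omega
      · have hup : (u : ℕ) < p := by by_contra hc; rw [if_neg hc] at u1; omega
        rw [if_pos hup] at u1
        have k1 := pathHeight_mono M.L hql
        have k2 := pathHeight_lt_of_mem hu hup
        rcases hxq with ⟨rfl, rfl⟩ | hpq
        · omega
        · have k3 := pathHeight_mono C hpq
          omega
  · obtain ⟨s, hs, hs1, hs2⟩ := exists_last_eq (f := δ) (c := 1) (x := x) hδ1 (by omega) (by omega)
    obtain ⟨t, ht, -, ht1, ht2⟩ := exists_first_eq (f := δ) (c := 1) (x := x + 1) (m := n)
      hδ2 hxn hδn.le (by omega)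
    refine ⟨s, t, 1, hs, ht, by simp only [hδ] at hs1; omega, by simp only [hδ] at ht1; omega,
      fun i h2 h3 => ?_⟩
    have h4 : 1 ≤ δ i := by
      rcases Nat.lt_or_ge x i with h5 | h5
      · exact ht2 i h5 h3
      · exact hs2 i h2 h5
    simp only [hδ] at h4
    have := hBi i
    have := hCi i
    have e1 := hU' i
    have e2 := hL' i
    split_ifs at e1 e2 <;> omega

theorem isPath_splice (M : LPM n) {B C : Finset (Fin n)} {s t : ℕ} {c : ℤ} (hC : M.IsPath C)
    (hst : s ≤ t) (hs : (pathHeight C s : ℤ) = pathHeight B s + c)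
    (ht : (pathHeight C t : ℤ) = pathHeight B t + c)
    (h : ∀ i, s ≤ i → i ≤ t →
      (pathHeight M.L i : ℤ) ≤ pathHeight B i + c ∧ pathHeight B i + c ≤ pathHeight M.U i) :
    M.IsPath (splice C B s t) := by
  have key := pathHeight_splice C B hst hs ht
  constructor
  -- The point `max n (t + 1)` lies beyond the window, where the splice agrees with `C`, and beyond
  -- `n`, where heights are cardinalities.
  · rw [← hC.1, ← pathHeight_of_le _ (le_max_left n (t + 1)),
      ← pathHeight_of_le C (le_max_left n (t + 1))]
    have := key (max n (t + 1))
    rw [if_neg (by omega)] at this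
    exact_mod_cast this
  · intro i
    have h1 := key i
    have h2 := hC.2 i
    split_ifs at h1 with h3
    · have := h i h3.1 h3.2; omega
    · omega

/-- A path `B` of `M'` through `x` that meets `X` maximally shows that `x` is not in the closure of
`X` in `M'`. If a path `C` of `M` that meets `X` maximally avoids `x`, a segment containing `x` is
exchanged; `card_filter_splice` keeps both paths maximal on `X`, and now the path of `M` contains
`x`. -/
theorem le_of_erase {M' M : LPM n} {l u : Fin n} (h : M.IsGoodPair l u)
    (hU : M'.U = M.U.erase u) (hL : M'.L = M.L.erase l) : M' ≤ M := by
  classical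
  refine .of_closure_subset M.toMatroid_ground M'.toMatroid_ground fun X x => ?_
  contrapose
  rw [notMem_closure_iff, notMem_closure_iff]
  rintro ⟨B, hB, hxB, hxX, hmax⟩
  obtain ⟨C, hC, hCmax⟩ := Set.exists_max_image {C | M.IsPath C}
    (fun C => (C.filter (· ∈ X)).card) (Set.toFinite _) ⟨M.U, M.isPath_U⟩
  by_cases hxC : x ∈ C
  · exact ⟨C, hC, hxC, hxX, hCmax⟩
  obtain ⟨s, t, c, hs, ht, hCs, hCt, hw⟩ := exists_exchange_window h hU hL hB hC hxB hxC
  have h1 := M.isPath_splice hC (by omega) hCs hCt fun i hi hi' =>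
    ⟨(hw i hi hi').1, (hw i hi hi').2.1⟩
  have h2 := M'.isPath_splice (c := -c) hB (B := C) (s := s) (t := t) (by omega) (by omega)
    (by omega) fun i hi hi' => by have := hw i hi hi'; omega
  refine ⟨_, h1, (mem_splice_of_window C B ⟨hs, ht⟩).2 hxB, hxX, fun D hD => ?_⟩
  have h3 := hmax _ h2
  have h4 := hCmax D hD
  have h5 := card_filter_splice C B X s t
  omega

theorem erasePair_le (M : LPM n) {l u : Fin n} (h : M.IsGoodPair l u) : M.erasePair l u h ≤ M :=
  le_of_erase h rfl rfl

end LPM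

/-! ### The quotient order in terms of diagrams -/

namespace LPM

variable {n : ℕ}

@[ext]
theorem ext_paths {M M' : LPM n} (hU : M.U = M'.U) (hL : M.L = M'.L) : M = M' := by
  cases M; cases M'
  simp only at hU hL
  subst hU hL
  rfl

/-- The combinatorial description of the order: the removed steps, paired off in increasing order,
are good pairs. -/
structure Dominates (M M' : LPM n) : Prop where
  subset_U : M'.U ⊆ M.U
  subset_L : M'.L ⊆ M.L
  good : ∀ u ∈ M.U \ M'.U, ∀ l ∈ M.L \ M'.L,
    pathHeight (M.U \ M'.U) u = pathHeight (M.L \ M'.L) l → M.IsGoodPair l u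

/-- The upper path is the greedy base: `x ∈ U` if and only if `x` is not in the closure of the
elements before it, and closures grow under a quotient. For `L` the elements after `x` play this
role. -/
theorem subset_U_of_le {M' M : LPM n} (h : M' ≤ M) : M'.U ⊆ M.U := by
  intro x hx
  have hc : ∀ C : Finset (Fin n), (C.filter (· ∈ {y : Fin n | (y : ℕ) < x})).card =
    pathHeight C x := fun C => by simp [pathHeight]
  have h1 : x ∉ M'.toMatroid.closure {y : Fin n | (y : ℕ) < x} := by
    rw [notMem_closure_iff]
    refine ⟨M'.U, M'.isPath_U, hx, by simp, fun C hC => ?_⟩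
    rw [hc, hc]
    exact (hC.2 x).2
  have h2 : x ∉ M.toMatroid.closure {y : Fin n | (y : ℕ) < x} :=
    fun h3 => h1 (IsMatroidQuotient.closure_subset h _ h3)
  rw [notMem_closure_iff] at h2
  obtain ⟨B, hB, hxB, -, hmax⟩ := h2
  have h3 := hmax _ M.isPath_U
  rw [hc, hc] at h3
  have h4 := pathHeight_succ_of_mem hxB
  have h5 := (hB.2 (x + 1)).2
  by_contra hxU
  have h6 := pathHeight_succ_of_notMem hxU
  omega

theorem subset_L_of_le {M' M : LPM n} (h : M' ≤ M) : M'.L ⊆ M.L := by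
  intro x hx
  have hc : ∀ C : Finset (Fin n), (C.filter (· ∈ {y : Fin n | (x : ℕ) < y})).card +
      pathHeight C (x + 1) = C.card := fun C => by
    rw [pathHeight, ← Finset.card_filter_add_card_filter_not (s := C) (fun y : Fin n => (x : ℕ) < y)]
    congr 2
    ext y
    simp
  have h1 : x ∉ M'.toMatroid.closure {y : Fin n | (x : ℕ) < y} := by
    rw [notMem_closure_iff]
    refine ⟨M'.L, M'.isPath_L, hx, by simp, fun C hC => ?_⟩
    have e1 := hc C
    have e2 := hc M'.L
    have := (hC.2 (x + 1)).1
    have := hC.1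
    have := M'.card_eq
    omega
  have h2 : x ∉ M.toMatroid.closure {y : Fin n | (x : ℕ) < y} :=
    fun h3 => h1 (IsMatroidQuotient.closure_subset h _ h3)
  rw [notMem_closure_iff] at h2
  obtain ⟨B, hB, hxB, -, hmax⟩ := h2
  have h3 := hmax _ M.isPath_L
  have e1 := hc B
  have e2 := hc M.L
  have := hB.1
  have := M.card_eq
  have h4 := pathHeight_succ_of_mem hxB
  have h5 := (hB.2 x).1
  by_contra hxL
  have h6 := pathHeight_succ_of_notMem hxL
  omega

theorem pathHeight_window_le {B C : Finset (Fin n)} (h : B ⊆ C) {i j : ℕ} (hij : i ≤ j) :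
    pathHeight B j + pathHeight C i ≤ pathHeight C j + pathHeight B i := by
  have h1 := pathHeight_sdiff h i
  have h2 := pathHeight_sdiff h j
  have h3 := pathHeight_mono (C \ B) hij
  omega

theorem exists_isPath (M : LPM n) (g : ℕ → ℕ) (h1 : ∀ i, g i ≤ g (i + 1))
    (h2 : ∀ i, g (i + 1) ≤ g i + 1)
    (h3 : ∀ i, pathHeight M.L i ≤ g i ∧ g i ≤ pathHeight M.U i) :
    ∃ B, M.IsPath B ∧ ∀ i ≤ n, pathHeight B i = g i := by
  obtain ⟨B, hB⟩ := exists_pathHeight (n := n) g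
    (by have := (h3 0).2; rw [pathHeight_zero] at this; omega) h1 h2
  have hcard : B.card = M.U.card := by
    rw [← pathHeight_end B, hB n le_rfl]
    have := h3 n
    rw [pathHeight_end, pathHeight_end, M.card_eq] at this
    omega
  refine ⟨B, ⟨hcard, fun i => ?_⟩, hB⟩
  rcases Nat.le_total i n with hi | hi
  · rw [hB i hi]; exact h3 i
  · rw [pathHeight_of_le _ hi, pathHeight_of_le _ hi, pathHeight_of_le _ hi, hcard, M.card_eq]
    exact ⟨le_rfl, le_rfl⟩

/-- If one of the two good pair inequalities fails for the k-th removed steps, some extremal path of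
one matroid contains, or is contained in, no path of the other: the number of steps between `u` and
`l` does not fit. -/
theorem dominates_of_le {M' M : LPM n} (h : M' ≤ M) : M.Dominates M' := by
  have hU := subset_U_of_le h
  have hL := subset_L_of_le h
  refine ⟨hU, hL, fun u hu l hl hul => ?_⟩
  have hu1 := pathHeight_succ_of_mem hu
  have hl1 := pathHeight_succ_of_mem hl
  rw [Finset.mem_sdiff] at hu hl
  have dU := pathHeight_sdiff hU
  have dL := pathHeight_sdiff hL
  have hu2 := pathHeight_succ_of_mem hu.1
  have hl2 := pathHeight_succ_of_mem hl.1
  have hu3 := pathHeight_succ_of_notMem hu.2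
  have hl3 := pathHeight_succ_of_notMem hl.2
  have dUu := dU u
  have dLl := dL l
  have hstep := pathHeight_succ_le (n := n)
  have hmono := pathHeight_le_succ (n := n)
  have hg1 : pathHeight M.L l ≤ pathHeight M.U u := by
    by_contra! hlt
    have hul' : (u : ℕ) + 1 ≤ l := by
      by_contra hc
      have h1 := pathHeight_mono M.U (show (l : ℕ) ≤ u by omega)
      have h2 := M.noncrossing l
      omega
    -- This path stays flat at the height of `U` after `u` until `L` pushes it up. From `u + 1` to
    -- `l` it gains one step less than every path of `M'` must gain.
    obtain ⟨B, hB, hBg⟩ := M.exists_isPath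
      (fun i => max (pathHeight M.L i) (min (pathHeight M.U i) (pathHeight M.U (u + 1))))
      (fun i => by have := hmono M.L i; have := hmono M.U i; omega)
      (fun i => by have := hstep M.L i; have := hstep M.U i; omega)
      (fun i => by have := M.noncrossing i; omega)
    obtain ⟨C, hC, hCB⟩ := exists_isPath_subset_of_le h hB
    have h1 := pathHeight_window_le hCB hul'
    rw [hBg (u + 1) u.2, hBg _ l.2.le] at h1
    have h2 := (hC.2 l).1
    have h3 := (hC.2 (u + 1)).2
    have h4 := M.noncrossing (u + 1)
    omega
  refine (M.isGoodPair_iff l u).2 ⟨hl.1, hu.1, hg1, ?_⟩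
  by_contra! hlt
  have hlu : (l : ℕ) + 1 ≤ u := by omega
  -- This path leaves `L'` at `l + 1` and climbs with every step until it is stopped by `U'`. From
  -- `l + 1` to `u` it gains more than any path of `M` can. Truncated subtraction makes the middle
  -- term constant before `l + 1`.
  obtain ⟨B, hB, hBg⟩ := M'.exists_isPath
    (fun i => min (pathHeight M'.U i)
      (max (pathHeight M'.L i) (pathHeight M'.L (l + 1) + (i - (l + 1)))))
    (fun i => by have := hmono M'.L i; have := hmono M'.U i; omega)
    (fun i => by have := hstep M'.L i; have := hstep M'.U i; omega)
    (fun i => by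
      have h0 := M'.noncrossing i
      rcases Nat.le_total i (l + 1) with hi | hi
      · have := pathHeight_mono M'.L hi; omega
      · omega)
  obtain ⟨C, hC, hBC⟩ := exists_isPath_superset_of_le h hB
  have h1 := pathHeight_window_le hBC hlu
  rw [hBg (l + 1) l.2, hBg _ u.2.le] at h1
  have h2 := (hC.2 u).2
  have h3 := (hC.2 (l + 1)).1
  have h4 := M'.noncrossing (l + 1)
  omega

theorem Dominates.card_sdiff {M M' : LPM n} (h : M.Dominates M') :
    (M.U \ M'.U).card = (M.L \ M'.L).card := by
  rw [Finset.card_sdiff_of_subset h.subset_U, Finset.card_sdiff_of_subset h.subset_L, M.card_eq,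
    M'.card_eq]

theorem Dominates.eq_of_card_le {M M' : LPM n} (h : M.Dominates M') (hc : M.U.card ≤ M'.U.card) :
    M' = M :=
  ext_paths (Finset.eq_of_subset_of_card_le h.subset_U hc)
    (Finset.eq_of_subset_of_card_le h.subset_L (by rwa [M.card_eq, M'.card_eq]))

theorem pathHeight_eq_zero {B : Finset (Fin n)} {i : ℕ} (h : pathHeight B i = 0) {x : Fin n}
    (hx : x ∈ B) : i ≤ x := by
  by_contra hc
  have := pathHeight_lt_of_mem hx (i := i) (by omega)
  omega

theorem pathHeight_sdiff_erase {B C : Finset (Fin n)} {x : Fin n} (hx : x ∈ B \ C) (i : ℕ) :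
    pathHeight (B \ C) i = pathHeight (B.erase x \ C) i + if (x : ℕ) < i then 1 else 0 := by
  rw [pathHeight_erase hx, Finset.erase_sdiff_comm]

/-- If `M` strictly dominates `M'`, remove the smallest removed steps first. -/
theorem Dominates.exists_erasePair {M M' : LPM n} (h : M.Dominates M') (hne : M' ≠ M) :
    ∃ (l u : Fin n) (hg : M.IsGoodPair l u), u ∈ M.U \ M'.U ∧ l ∈ M.L \ M'.L ∧
      (∀ x ∈ M.U \ M'.U, u ≤ x) ∧ (∀ x ∈ M.L \ M'.L, l ≤ x) ∧
      (M.erasePair l u hg).Dominates M' := by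
  have hpos : 0 < (M.U \ M'.U).card := by
    rw [Finset.card_sdiff_of_subset h.subset_U]
    by_contra hc
    exact hne (h.eq_of_card_le (by omega))
  obtain ⟨u, hu, hu0⟩ := exists_pathHeight_eq hpos
  obtain ⟨l, hl, hl0⟩ := exists_pathHeight_eq (h.card_sdiff ▸ hpos)
  have hg := h.good u hu l hl (by rw [hu0, hl0])
  have humin : ∀ x ∈ M.U \ M'.U, u ≤ x := fun x hx => Fin.le_def.2 (pathHeight_eq_zero hu0 hx)
  have hlmin : ∀ x ∈ M.L \ M'.L, l ≤ x := fun x hx => Fin.le_def.2 (pathHeight_eq_zero hl0 hx)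
  refine ⟨l, u, hg, hu, hl, humin, hlmin, ?_, ?_, ?_⟩
  · exact Finset.subset_erase.2 ⟨h.subset_U, (Finset.mem_sdiff.1 hu).2⟩
  · exact Finset.subset_erase.2 ⟨h.subset_L, (Finset.mem_sdiff.1 hl).2⟩
  · intro v hv m hm hvm
    have hv' : v ∈ M.U \ M'.U ∧ v ≠ u := by
      simp only [erasePair, Finset.mem_sdiff, Finset.mem_erase] at hv ⊢
      tauto
    have hm' : m ∈ M.L \ M'.L ∧ m ≠ l := by
      simp only [erasePair, Finset.mem_sdiff, Finset.mem_erase] at hm ⊢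
      tauto
    have huv : (u : ℕ) < v := lt_of_le_of_ne (humin v hv'.1) (fun e => hv'.2 (Fin.ext e.symm))
    have hlm : (l : ℕ) < m := lt_of_le_of_ne (hlmin m hm'.1) (fun e => hm'.2 (Fin.ext e.symm))
    -- The erased steps precede `v` and `m`, so both heights drop by one and the good pair
    -- inequalities for `(m, v)` do not change.
    have e1 := pathHeight_sdiff_erase hu v
    have e2 := pathHeight_sdiff_erase hl m
    have e3 := pathHeight_erase (Finset.mem_sdiff.1 hu).1 v
    have e4 := pathHeight_erase (Finset.mem_sdiff.1 hl).1 m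
    rw [if_pos huv] at e1 e3
    rw [if_pos hlm] at e2 e4
    simp only [erasePair] at hvm
    have h5 := h.good v hv'.1 m hm'.1 (by omega)
    rw [isGoodPair_iff] at h5 ⊢
    refine ⟨(Finset.mem_sdiff.1 hm).1, (Finset.mem_sdiff.1 hv).1, ?_⟩
    simp only [erasePair]
    omega

theorem Dominates.le {M M' : LPM n} (h : M.Dominates M') : M' ≤ M := by
  by_cases hne : M' = M
  · exact hne.le
  obtain ⟨l, u, hg, hu, -, -, -, h'⟩ := h.exists_erasePair hne
  have : (M.erasePair l u hg).U.card < M.U.card :=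
    Finset.card_erase_lt_of_mem hg.2.1
  exact h'.le.trans (M.erasePair_le hg)
termination_by M.U.card

/-! ### The rank function and the covers -/

theorem card_lt_of_lt {M' M : LPM n} (h : M' < M) : M'.U.card < M.U.card := by
  by_contra hc
  exact h.ne ((dominates_of_le h.le).eq_of_card_le (by omega))

theorem erasePair_covBy (M : LPM n) {l u : Fin n} (h : M.IsGoodPair l u) :
    M.erasePair l u h ⋖ M := by
  have hc : (M.erasePair l u h).U.card + 1 = M.U.card := Finset.card_erase_add_one h.2.1
  refine ⟨lt_of_le_of_ne (M.erasePair_le h) (fun e => by rw [e] at hc; omega), fun c h1 h2 => ?_⟩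
  have := card_lt_of_lt h1
  have := card_lt_of_lt h2
  omega

/-- Removing the smallest pair yields an element strictly below `M` and still above `M'`; in a cover
it has to be `M'`. -/
theorem exists_erasePair_of_covBy {M' M : LPM n} (h : M' ⋖ M) :
    ∃ (l u : Fin n) (hg : M.IsGoodPair l u), M' = M.erasePair l u hg := by
  obtain ⟨l, u, hg, -, -, -, -, h'⟩ := (dominates_of_le h.le).exists_erasePair h.lt.ne
  refine ⟨l, u, hg, ?_⟩
  by_contra hne
  exact h.2 (lt_of_le_of_ne h'.le hne) (M.erasePair_covBy hg).lt

/-- The rank zero lattice path matroid. -/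
def empty (n : ℕ) : LPM n := ⟨∅, ∅, rfl, fun _ => le_rfl⟩

theorem isBot_empty : IsBot (empty n) := by
  intro M
  refine Dominates.le ⟨by simp [empty], by simp [empty], fun u hu l hl hul => ?_⟩
  simp only [empty, Finset.sdiff_empty] at hu hl hul
  rw [isGoodPair_iff]
  -- The k-th north step of the lower path never precedes that of the upper path.
  have : (u : ℕ) ≤ l := by
    by_contra hc
    have h1 := pathHeight_lt_of_mem hl (i := u) (by omega)
    have h2 := M.noncrossing u
    have h3 := pathHeight_lt_of_mem hl (i := l + 1) (by omega)
    omega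
  exact ⟨hl, hu, by omega, by omega⟩

theorem isRankFunction_card : IsRankFunction (fun M : LPM n => M.U.card) where
  strictMono _ _ h := card_lt_of_lt h
  isMin M h := by
    have : M = empty n := le_antisymm (h (isBot_empty M)) (isBot_empty M)
    simp [this, empty]
  covBy M' M h := by
    obtain ⟨l, u, hg, rfl⟩ := exists_erasePair_of_covBy h
    exact (Finset.card_erase_add_one hg.2.1).symm

end LPM

/-! ## Words of saturated chains -/

namespace EdgeLabeling

variable {P Λ : Type*} [PartialOrder P]

/-- The edges of a chain and of its extension have endpoints that are equal only propositionally;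
this transports their labels. -/
theorem lab_congr (lab : EdgeLabeling P Λ) {x x' y y' : P} (h : x ⋖ y) (h' : x' ⋖ y')
    (hx : x = x') (hy : y = y') : lab h = lab h' := by
  subst hx hy
  rfl

theorem word_singleton (lab : EdgeLabeling P Λ) (x : P) :
    lab.word (RelSeries.singleton _ x) = [] := rfl

theorem word_snoc (lab : EdgeLabeling P Λ) (c : SaturatedChain P) (y : P) (h : c.last ⋖ y) :
    lab.word (c.snoc y h) = lab.word c ++ [lab h] := by
  have e := List.ofFn_succ' (n := c.length) fun i : Fin (c.length + 1) => lab ((c.snoc y h).step i)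
  refine Eq.trans e ?_
  rw [List.concat_eq_append]
  congr 1
  · refine congrArg List.ofFn (funext fun i => ?_)
    exact lab.lab_congr _ _ (c.snoc_castSucc y h _) (c.snoc_castSucc y h i.succ)
  · congr 1
    exact lab.lab_congr _ _ (c.snoc_castSucc y h (Fin.last _)) (c.last_snoc' y h)

/-- If the top of an edge and its label determine the bottom, then the top of a saturated chain and
its word determine the chain. -/
theorem eq_of_word_eq (lab : EdgeLabeling P Λ)
    (hlab : ∀ ⦃x x' y : P⦄ (h : x ⋖ y) (h' : x' ⋖ y), lab h = lab h' → x = x')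
    (c c' : SaturatedChain P) (hl : c.last = c'.last) (hw : lab.word c = lab.word c') : c = c' := by
  induction c using RelSeries.inductionOn' generalizing c' with
  | singleton x =>
    induction c' using RelSeries.inductionOn' with
    | singleton x' => simp only [RelSeries.last_singleton] at hl; rw [hl]
    | snoc p y h _ => rw [word_snoc, word_singleton] at hw; simp at hw
  | snoc p y h ih =>
    induction c' using RelSeries.inductionOn' with
    | singleton x' => rw [word_snoc, word_singleton] at hw; simp at hw
    | snoc p' y' h' _ =>
      simp only [RelSeries.last_snoc] at hl
      subst hl
      rw [word_snoc, word_snoc] at hw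
      obtain ⟨h1, h2⟩ := List.append_inj' hw rfl
      have h3 : lab h = lab h' := by simpa using h2
      obtain rfl := ih p' (hlab h h' h3) h1
      rfl

end EdgeLabeling

/-! ## The good pair labeling -/

namespace LPM

variable {n : ℕ}

theorem exists_label {M' M : LPM n} (h : M' ⋖ M) : ∃ p : Fin n × Fin n,
    M.IsGoodPair p.2 p.1 ∧ M'.U = M.U.erase p.1 ∧ M'.L = M.L.erase p.2 := by
  obtain ⟨l, u, hg, rfl⟩ := exists_erasePair_of_covBy h
  exact ⟨(u, l), hg, rfl, rfl⟩

/-- The good pair labeling. -/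
noncomputable def goodPairLabeling (n : ℕ) : EdgeLabeling (LPM n) (LabelPoset n) :=
  fun _ _ h => OrderDual.toDual (exists_label h).choose

/-- The north step removed from the upper path in a cover. -/
noncomputable def coverU {M' M : LPM n} (h : M' ⋖ M) : Fin n :=
  (OrderDual.ofDual (goodPairLabeling n h)).1

/-- The north step removed from the lower path in a cover. -/
noncomputable def coverL {M' M : LPM n} (h : M' ⋖ M) : Fin n :=
  (OrderDual.ofDual (goodPairLabeling n h)).2

theorem isGoodPair_cover {M' M : LPM n} (h : M' ⋖ M) : M.IsGoodPair (coverL h) (coverU h) :=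
  (exists_label h).choose_spec.1

theorem U_eq_erase {M' M : LPM n} (h : M' ⋖ M) : M'.U = M.U.erase (coverU h) :=
  (exists_label h).choose_spec.2.1

theorem L_eq_erase {M' M : LPM n} (h : M' ⋖ M) : M'.L = M.L.erase (coverL h) :=
  (exists_label h).choose_spec.2.2

theorem coverU_mem {M' M : LPM n} (h : M' ⋖ M) : coverU h ∈ M.U := (isGoodPair_cover h).2.1

theorem coverL_mem {M' M : LPM n} (h : M' ⋖ M) : coverL h ∈ M.L := (isGoodPair_cover h).1

theorem isGoodPairLabeling_goodPairLabeling : IsGoodPairLabeling (goodPairLabeling n) := by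
  intro M' M h
  refine ⟨?_, ?_, ?_, ?_, isGoodPair_cover h⟩
  · rw [U_eq_erase h]; exact Finset.erase_subset _ _
  · rw [U_eq_erase h]; exact Finset.sdiff_erase_self (coverU_mem h)
  · rw [L_eq_erase h]; exact Finset.erase_subset _ _
  · rw [L_eq_erase h]; exact Finset.sdiff_erase_self (coverL_mem h)

theorem goodPairLabeling_eq_iff {M' M N' N : LPM n} (h : M' ⋖ M) (h' : N' ⋖ N) :
    goodPairLabeling n h = goodPairLabeling n h' ↔
      coverU h = coverU h' ∧ coverL h = coverL h' := by
  rw [coverU, coverU, coverL, coverL, ← Prod.ext_iff]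
  exact OrderDual.ofDual.injective.eq_iff.symm

theorem goodPairLabeling_le_iff {M' M N' N : LPM n} (h : M' ⋖ M) (h' : N' ⋖ N) :
    goodPairLabeling n h ≤ goodPairLabeling n h' ↔
      coverU h' ≤ coverU h ∧ coverL h' ≤ coverL h := Iff.rfl

/-- The labeling is defined by choice, but the sets of the cover determine the label. -/
theorem cover_eq_of_eq_erase {M' M : LPM n} (h : M' ⋖ M) {u l : Fin n} (hu : u ∈ M.U)
    (hl : l ∈ M.L) (hU : M'.U = M.U.erase u) (hL : M'.L = M.L.erase l) :
    coverU h = u ∧ coverL h = l := by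
  have h1 := U_eq_erase h
  have h2 := L_eq_erase h
  rw [hU] at h1
  rw [hL] at h2
  exact ⟨(Finset.erase_injOn _ hu (coverU_mem h) h1).symm,
    (Finset.erase_injOn _ hl (coverL_mem h) h2).symm⟩

theorem eq_of_label_eq {M N M' : LPM n} (h : M ⋖ M') (h' : N ⋖ M')
    (he : goodPairLabeling n h = goodPairLabeling n h') : M = N := by
  rw [goodPairLabeling_eq_iff] at he
  exact ext_paths (by rw [U_eq_erase h, U_eq_erase h', he.1])
    (by rw [L_eq_erase h, L_eq_erase h', he.2])

/-- The upper end of a cover and its label determine the lower end, so a chain can be read off from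
its word, from the top downwards. -/
theorem fallingWordsUnique : (goodPairLabeling n).FallingWordsUnique := by
  rintro x y c c' ⟨-, hc⟩ ⟨-, hc'⟩ - - hw
  exact EdgeLabeling.eq_of_word_eq _ (fun _ _ _ h h' => eq_of_label_eq h h') c c'
    (hc.trans hc'.symm) hw

/-- The first coordinates of the labels of a saturated chain are the steps removed from `U`. -/
theorem map_fst_word (c : SaturatedChain (LPM n)) :
    (((goodPairLabeling n).word c).map fun p => (OrderDual.ofDual p).1 : Multiset (Fin n)) +
      c.head.U.val = c.last.U.val := by
  induction c using RelSeries.inductionOn' with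
  | singleton x => simp [EdgeLabeling.word_singleton]
  | snoc p y h ih =>
    rw [EdgeLabeling.word_snoc, RelSeries.head_snoc, RelSeries.last_snoc, List.map_append,
      ← Multiset.coe_add, add_right_comm, ih, U_eq_erase h, Finset.erase_val, add_comm]
    exact Multiset.cons_erase (coverU_mem h)

/-- The second coordinates of the labels of a saturated chain are the steps removed from `L`. -/
theorem map_snd_word (c : SaturatedChain (LPM n)) :
    (((goodPairLabeling n).word c).map fun p => (OrderDual.ofDual p).2 : Multiset (Fin n)) +
      c.head.L.val = c.last.L.val := by
  induction c using RelSeries.inductionOn' with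
  | singleton x => simp [EdgeLabeling.word_singleton]
  | snoc p y h ih =>
    rw [EdgeLabeling.word_snoc, RelSeries.head_snoc, RelSeries.last_snoc, List.map_append,
      ← Multiset.coe_add, add_right_comm, ih, L_eq_erase h, Finset.erase_val, add_comm]
    exact Multiset.cons_erase (coverL_mem h)

/-- The label order is reversed, so both coordinates decrease weakly along such a word. A sorted
list is determined by its multiset of entries. -/
theorem eq_of_isChain_le {w w' : List (LabelPoset n)} (hw : w.IsChain (· ≤ ·))
    (hw' : w'.IsChain (· ≤ ·))
    (h1 : (w.map fun p => (OrderDual.ofDual p).1).Perm (w'.map fun p => (OrderDual.ofDual p).1))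
    (h2 : (w.map fun p => (OrderDual.ofDual p).2).Perm (w'.map fun p => (OrderDual.ofDual p).2)) :
    w = w' := by
  have e1 : ∀ {w : List (LabelPoset n)}, w.IsChain (· ≤ ·) →
      (w.map fun p => (OrderDual.ofDual p).1).Pairwise (· ≥ ·) := fun hw =>
    List.pairwise_map.2 ((List.isChain_iff_pairwise.1 hw).imp fun h => h.1)
  have e2 : ∀ {w : List (LabelPoset n)}, w.IsChain (· ≤ ·) →
      (w.map fun p => (OrderDual.ofDual p).2).Pairwise (· ≥ ·) := fun hw =>
    List.pairwise_map.2 ((List.isChain_iff_pairwise.1 hw).imp fun h => h.2)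
  have f1 := h1.eq_of_pairwise' (e1 hw) (e1 hw')
  have f2 := h2.eq_of_pairwise' (e2 hw) (e2 hw')
  have hz : ∀ w : List (LabelPoset n), w = ((w.map fun p => (OrderDual.ofDual p).1).zip
      (w.map fun p => (OrderDual.ofDual p).2)).map OrderDual.toDual := fun w => by
    induction w with
    | nil => rfl
    | cons a w ih => rw [List.map_cons, List.map_cons, List.zip_cons_cons, List.map_cons, ← ih]; rfl
  rw [hz w, hz w', f1, f2]

theorem weaklyIncreasing_unique {x y : LPM n} {c c' : SaturatedChain (LPM n)}
    (hc : c.FromTo x y) (hc' : c'.FromTo x y)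
    (hw : (goodPairLabeling n).WeaklyIncreasing c)
    (hw' : (goodPairLabeling n).WeaklyIncreasing c') : c = c' := by
  refine EdgeLabeling.eq_of_word_eq _ (fun _ _ _ h h' => eq_of_label_eq h h') c c'
    (hc.2.trans hc'.2.symm) (eq_of_isChain_le hw hw' ?_ ?_)
  · have h1 := map_fst_word c
    have h2 := map_fst_word c'
    rw [hc.1, hc.2] at h1
    rw [hc'.1, hc'.2, ← h1] at h2
    exact (Multiset.coe_eq_coe.1 (add_right_cancel h2)).symm
  · have h1 := map_snd_word c
    have h2 := map_snd_word c'
    rw [hc.1, hc.2] at h1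
    rw [hc'.1, hc'.2, ← h1] at h2
    exact (Multiset.coe_eq_coe.1 (add_right_cancel h2)).symm

theorem Increasing.weaklyIncreasing {c : SaturatedChain (LPM n)}
    (h : (goodPairLabeling n).Increasing c) : (goodPairLabeling n).WeaklyIncreasing c :=
  List.IsChain.imp (fun _ _ => le_of_lt) h

/-- The top label has to be the largest one, that is, the pair of smallest removed steps. The rest
of the chain is found by recursion. -/
theorem exists_increasing {x y : LPM n} (hxy : x ≤ y) :
    ∃ c : SaturatedChain (LPM n), c.FromTo x y ∧ (goodPairLabeling n).Increasing c := by
  by_cases hne : x = y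
  · subst hne
    exact ⟨RelSeries.singleton _ x, ⟨rfl, rfl⟩, List.IsChain.nil⟩
  obtain ⟨l, u, hg, hu, hl, humin, hlmin, hd⟩ := (dominates_of_le hxy).exists_erasePair hne
  have : (y.erasePair l u hg).U.card < y.U.card := Finset.card_erase_lt_of_mem hg.2.1
  obtain ⟨c, hc, hinc⟩ := exists_increasing hd.le
  have hcov : c.last ⋖ y := by rw [hc.2]; exact y.erasePair_covBy hg
  have hcul := cover_eq_of_eq_erase hcov hg.2.1 hg.1 (by rw [hc.2]; rfl) (by rw [hc.2]; rfl)
  refine ⟨c.snoc y hcov, ⟨by rw [RelSeries.head_snoc, hc.1], RelSeries.last_snoc _ _ _⟩, ?_⟩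
  unfold EdgeLabeling.Increasing
  rw [EdgeLabeling.word_snoc]
  refine hinc.append (List.isChain_singleton _) fun a ha b hb => ?_
  simp only [List.head?_cons, Option.mem_def, Option.some.injEq] at hb
  subst hb
  have ha' := List.mem_of_mem_getLast? ha
  have h1 := map_fst_word c
  have h2 := map_snd_word c
  rw [hc.1, hc.2] at h1 h2
  have hnd1 := (y.erasePair l u hg).U.nodup
  have hnd2 := (y.erasePair l u hg).L.nodup
  rw [← h1, Multiset.nodup_add] at hnd1
  rw [← h2, Multiset.nodup_add] at hnd2
  have m1 : (OrderDual.ofDual a).1 ∈ (((goodPairLabeling n).word c).map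
      fun p => (OrderDual.ofDual p).1 : Multiset (Fin n)) :=
    Multiset.mem_coe.2 (List.mem_map_of_mem ha')
  have m2 : (OrderDual.ofDual a).2 ∈ (((goodPairLabeling n).word c).map
      fun p => (OrderDual.ofDual p).2 : Multiset (Fin n)) :=
    Multiset.mem_coe.2 (List.mem_map_of_mem ha')
  have k1 : (OrderDual.ofDual a).1 ∈ (y.erasePair l u hg).U :=
    Finset.mem_def.2 (h1 ▸ Multiset.mem_add.2 (Or.inl m1))
  have k2 : (OrderDual.ofDual a).2 ∈ (y.erasePair l u hg).L :=
    Finset.mem_def.2 (h2 ▸ Multiset.mem_add.2 (Or.inl m2))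
  have j1 : (OrderDual.ofDual a).1 ∉ x.U := Multiset.disjoint_left.1 hnd1.2.2 m1
  have j2 : (OrderDual.ofDual a).2 ∉ x.L := Multiset.disjoint_left.1 hnd2.2.2 m2
  obtain ⟨k3, k4⟩ := Finset.mem_erase.1 k1
  obtain ⟨-, k5⟩ := Finset.mem_erase.1 k2
  refine lt_of_le_of_ne ?_ ?_
  · change coverU hcov ≤ _ ∧ coverL hcov ≤ _
    rw [hcul.1, hcul.2]
    exact ⟨humin _ (Finset.mem_sdiff.2 ⟨k4, j1⟩), hlmin _ (Finset.mem_sdiff.2 ⟨k5, j2⟩)⟩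
  -- The step `u` is no longer in the upper path below, so an earlier label cannot have it as first
  -- coordinate.
  · intro e
    apply k3
    rw [e]
    exact hcul.1
termination_by y.U.card

theorem isER : (goodPairLabeling n).IsER := by
  intro x y hxy
  obtain ⟨c, hc, hinc⟩ := exists_increasing hxy
  exact ⟨c, ⟨hc, hinc⟩, fun c' hc' => weaklyIncreasing_unique hc'.1 hc
    (Increasing.weaklyIncreasing hc'.2) (Increasing.weaklyIncreasing hinc)⟩

theorem existsUnique_weaklyIncreasing {x y : LPM n} (hxy : x ≤ y) :
    ∃! c : SaturatedChain (LPM n), c.FromTo x y ∧ (goodPairLabeling n).WeaklyIncreasing c := by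
  obtain ⟨c, hc, hinc⟩ := exists_increasing hxy
  exact ⟨c, ⟨hc, Increasing.weaklyIncreasing hinc⟩, fun c' hc' => weaklyIncreasing_unique hc'.1 hc
    hc'.2 (Increasing.weaklyIncreasing hinc)⟩

/-- The upper label `(u₁, l₁)` is smaller in both coordinates. Restoring it raises both heights at
`(u₂, l₂)` by one, and removing `(u₂, l₂)` does not affect the heights at `(u₁, l₁)`. So both pairs
stay good in the other order. -/
theorem rankTwoSwitching : (goodPairLabeling n).RankTwoSwitching := by
  intro x y z hxy hyz hlt
  have hle := (goodPairLabeling_le_iff hxy hyz).1 hlt.le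
  have hU1 := U_eq_erase hyz
  have hL1 := L_eq_erase hyz
  have hU2 := U_eq_erase hxy
  have hL2 := L_eq_erase hxy
  have hg1 := isGoodPair_cover hyz
  have hg2 := isGoodPair_cover hxy
  set u₁ := coverU hyz with hu₁
  set l₁ := coverL hyz with hl₁
  set u₂ := coverU hxy with hu₂
  set l₂ := coverL hxy with hl₂
  have hu₂y := hg2.2.1
  have hl₂y := hg2.1
  rw [hU1, Finset.mem_erase] at hu₂y
  rw [hL1, Finset.mem_erase] at hl₂y
  have hu : (u₁ : ℕ) < u₂ := lt_of_le_of_ne hle.1 fun e => hu₂y.1 (Fin.ext e.symm)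
  have hl : (l₁ : ℕ) < l₂ := lt_of_le_of_ne hle.2 fun e => hl₂y.1 (Fin.ext e.symm)
  have hg2z : z.IsGoodPair l₂ u₂ := by
    rw [isGoodPair_iff] at hg2 ⊢
    have e1 := pathHeight_erase hg1.2.1 u₂
    have e2 := pathHeight_erase hg1.1 l₂
    rw [if_pos hu, ← hU1] at e1
    rw [if_pos hl, ← hL1] at e2
    exact ⟨hl₂y.2, hu₂y.2, by omega, by omega⟩
  set y' := z.erasePair l₂ u₂ hg2z with hy'
  have hg1y : y'.IsGoodPair l₁ u₁ := by
    rw [isGoodPair_iff] at hg1 ⊢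
    have e1 := pathHeight_erase hg2z.2.1 u₁
    have e2 := pathHeight_erase hg2z.1 l₁
    rw [if_neg (by omega)] at e1 e2
    exact ⟨Finset.mem_erase.2 ⟨hl₂y.1.symm, hg1.1⟩, Finset.mem_erase.2 ⟨hu₂y.1.symm, hg1.2.1⟩,
      by simp only [hy', erasePair]; omega, by simp only [hy', erasePair]; omega⟩
  have hx : x = y'.erasePair l₁ u₁ hg1y := by
    refine ext_paths ?_ ?_
    · rw [hU2, hU1, Finset.erase_right_comm]; rfl
    · rw [hL2, hL1, Finset.erase_right_comm]; rfl
  have hz' : y' ⋖ z := z.erasePair_covBy hg2z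
  have hx' : x ⋖ y' := hx ▸ y'.erasePair_covBy hg1y
  have hxl := cover_eq_of_eq_erase hx' hg1y.2.1 hg1y.1 (by rw [hx]; rfl) (by rw [hx]; rfl)
  have hzl := cover_eq_of_eq_erase hz' hg2z.2.1 hg2z.1 rfl rfl
  have hlz : goodPairLabeling n hz' = goodPairLabeling n hxy :=
    (goodPairLabeling_eq_iff _ _).2 hzl
  refine ⟨y', ⟨hx', hz', (goodPairLabeling_eq_iff _ _).2 hxl, hlz⟩, ?_⟩
  rintro w ⟨hxw, hwz, -, hw⟩
  exact eq_of_label_eq hwz hz' (hw.trans hlz.symm)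

theorem isEW : (goodPairLabeling n).IsEW := ⟨isER, rankTwoSwitching, fallingWordsUnique⟩

end LPM

/-! ## Heaps of labels

The Whitney dual consists of the saturated chains that start at the minimum, up to switching of
comparable neighbouring labels. Such a class is the heap of its labels: the set of its labels
together with the order in which the incomparable ones occur. -/

section Matching

variable {n : ℕ}

/-- Two labels cross if they are incomparable in the label poset. -/
def Crossing (a b : Fin n × Fin n) : Prop := a.1 < b.1 ∧ b.2 < a.2 ∨ b.1 < a.1 ∧ a.2 < b.2

theorem Crossing.symm {a b : Fin n × Fin n} (h : Crossing a b) : Crossing b a := Or.symm h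

/-- The elements of two sets, paired off in increasing order. -/
def matching (B C : Finset (Fin n)) : Finset (Fin n × Fin n) :=
  Finset.univ.filter fun p => p.1 ∈ B ∧ p.2 ∈ C ∧ pathHeight B p.1 = pathHeight C p.2

theorem mem_matching {B C : Finset (Fin n)} {p : Fin n × Fin n} :
    p ∈ matching B C ↔ p.1 ∈ B ∧ p.2 ∈ C ∧ pathHeight B p.1 = pathHeight C p.2 := by
  simp [matching]

theorem matching_fst_injOn {B C : Finset (Fin n)} {p q : Fin n × Fin n} (hp : p ∈ matching B C)
    (hq : q ∈ matching B C) (h : p.1 = q.1) : p = q := by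
  rw [mem_matching] at hp hq
  exact Prod.ext h (pathHeight_injOn hp.2.1 hq.2.1 (by rw [← hp.2.2, ← hq.2.2, h]))

theorem matching_snd_injOn {B C : Finset (Fin n)} {p q : Fin n × Fin n} (hp : p ∈ matching B C)
    (hq : q ∈ matching B C) (h : p.2 = q.2) : p = q := by
  rw [mem_matching] at hp hq
  exact Prod.ext (pathHeight_injOn hp.1 hq.1 (by rw [hp.2.2, hq.2.2, h])) h

theorem not_crossing_of_mem_matching {B C : Finset (Fin n)} {p q : Fin n × Fin n}
    (hp : p ∈ matching B C) (hq : q ∈ matching B C) : ¬ Crossing p q := by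
  rw [mem_matching] at hp hq
  rintro (⟨h1, h2⟩ | ⟨h1, h2⟩)
  · have := pathHeight_lt_of_mem hp.1 h1
    have := pathHeight_lt_of_mem hq.2.1 h2
    omega
  · have := pathHeight_lt_of_mem hq.1 h1
    have := pathHeight_lt_of_mem hp.2.1 h2
    omega

theorem image_fst_matching {B C : Finset (Fin n)} (h : B.card = C.card) :
    (matching B C).image Prod.fst = B := by
  ext x
  simp only [Finset.mem_image, mem_matching]
  constructor
  · rintro ⟨p, hp, rfl⟩; exact hp.1
  · intro hx
    obtain ⟨y, hy, hxy⟩ := exists_pathHeight_eq (h ▸ pathHeight_lt_card hx)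
    exact ⟨(x, y), ⟨hx, hy, hxy.symm⟩, rfl⟩

theorem image_snd_matching {B C : Finset (Fin n)} (h : B.card = C.card) :
    (matching B C).image Prod.snd = C := by
  ext x
  simp only [Finset.mem_image, mem_matching]
  constructor
  · rintro ⟨p, hp, rfl⟩; exact hp.2.1
  · intro hx
    obtain ⟨y, hy, hxy⟩ := exists_pathHeight_eq (h ▸ pathHeight_lt_card hx)
    exact ⟨(y, x), ⟨hy, hx, hxy⟩, rfl⟩

theorem pathHeight_image_fst {T : Finset (Fin n × Fin n)}
    (hT : ∀ a ∈ T, ∀ b ∈ T, a.1 = b.1 → a = b) (i : ℕ) :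
    pathHeight (T.image Prod.fst) i = (T.filter fun a => (a.1 : ℕ) < i).card := by
  rw [pathHeight, Finset.filter_image, Finset.card_image_of_injOn]
  intro a ha b hb hab
  exact hT a (Finset.mem_filter.1 ha).1 b (Finset.mem_filter.1 hb).1 hab

theorem pathHeight_image_snd {T : Finset (Fin n × Fin n)}
    (hT : ∀ a ∈ T, ∀ b ∈ T, a.2 = b.2 → a = b) (i : ℕ) :
    pathHeight (T.image Prod.snd) i = (T.filter fun a => (a.2 : ℕ) < i).card := by
  rw [pathHeight, Finset.filter_image, Finset.card_image_of_injOn]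
  intro a ha b hb hab
  exact hT a (Finset.mem_filter.1 ha).1 b (Finset.mem_filter.1 hb).1 hab

/-- Without crossings the two coordinates order `T` in the same way, so each element has the same
position in both projections. -/
theorem matching_image {T : Finset (Fin n × Fin n)}
    (h1 : ∀ a ∈ T, ∀ b ∈ T, a.1 = b.1 → a = b) (h2 : ∀ a ∈ T, ∀ b ∈ T, a.2 = b.2 → a = b)
    (h3 : ∀ a ∈ T, ∀ b ∈ T, ¬ Crossing a b) :
    matching (T.image Prod.fst) (T.image Prod.snd) = T := by
  have key : ∀ p ∈ T, p ∈ matching (T.image Prod.fst) (T.image Prod.snd) := by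
    intro p hp
    refine mem_matching.2 ⟨Finset.mem_image_of_mem _ hp, Finset.mem_image_of_mem _ hp, ?_⟩
    rw [pathHeight_image_fst h1, pathHeight_image_snd h2]
    congr 1
    refine Finset.filter_congr fun a ha => ?_
    have e1 := h1 a ha p hp
    have e2 := h2 a ha p hp
    have e3 := h3 a ha p hp
    simp only [Crossing, Fin.ext_iff, Fin.lt_def] at e1 e2 e3
    constructor
    · intro h
      by_contra hc
      by_cases h4 : (a.2 : ℕ) = p.2
      · rw [e2 h4] at h; omega
      · omega
    · intro h
      by_contra hc
      by_cases h4 : (a.1 : ℕ) = p.1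
      · rw [e1 h4] at h; omega
      · omega
  refine Finset.Subset.antisymm (fun p hp => ?_) key
  obtain ⟨q, hq, hqp⟩ := Finset.mem_image.1 (mem_matching.1 hp).1
  rwa [← matching_fst_injOn (key q hq) hp hqp]

open Classical in
/-- Among the labels of `T`, only those that cross `b` contribute to the difference of the heights
of `b` on the two paths. -/
theorem card_crossing_balance (T : Finset (Fin n × Fin n)) (b : Fin n × Fin n)
    (hT : ∀ a ∈ T, a = b ∨ a.1 ≠ b.1 ∧ a.2 ≠ b.2) :
    (T.filter fun a => Crossing a b ∧ a.1 < b.1).card + (T.filter fun a => (a.2 : ℕ) < b.2).card =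
      (T.filter fun a => Crossing a b ∧ a.2 < b.2).card +
        (T.filter fun a => (a.1 : ℕ) < b.1).card := by
  simp only [Finset.card_filter, ← Finset.sum_add_distrib]
  refine Finset.sum_congr rfl fun a ha => ?_
  rcases hT a ha with rfl | ⟨h1, h2⟩
  · simp
  · simp only [Crossing, ne_eq, Fin.ext_iff, Fin.lt_def] at h1 h2 ⊢
    rcases lt_or_gt_of_ne h1 with h3 | h3 <;> rcases lt_or_gt_of_ne h2 with h4 | h4 <;>
      simp [h3, h4, h3.not_gt, h4.not_gt]

end Matching

open Classical in
/-- A heap of labels: a set of labels with distinct coordinates, in which `R` says for any two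
crossing labels which one comes first. Each label `(u, l)` has to be good at the time when it comes
on top of the labels that precede it. -/
structure Heap (n : ℕ) where
  /-- the set of labels -/
  S : Finset (Fin n × Fin n)
  /-- the order of crossing labels -/
  R : Fin n × Fin n → Fin n × Fin n → Prop
  mem_left : ∀ {a b}, R a b → a ∈ S
  mem_right : ∀ {a b}, R a b → b ∈ S
  crossing : ∀ {a b}, R a b → Crossing a b
  total : ∀ a ∈ S, ∀ b ∈ S, Crossing a b → R a b ∨ R b a
  -- `R` relates crossing labels only and need not be transitive; the level function `f` stands for
  -- a linear extension.
  acyclic : ∃ f : Fin n × Fin n → ℕ, ∀ a b, R a b → f a < f b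
  fst_inj : ∀ a ∈ S, ∀ b ∈ S, a.1 = b.1 → a = b
  snd_inj : ∀ a ∈ S, ∀ b ∈ S, a.2 = b.2 → a = b
  -- Labels that do not cross `b` contribute equally to both heights at `b`, so the good pair
  -- inequalities can be stated with the crossing predecessors alone. This makes them independent of
  -- the chosen linear extension.
  good : ∀ b ∈ S,
    (Finset.univ.filter fun a => R a b ∧ a.2 < b.2).card ≤
      (Finset.univ.filter fun a => R a b ∧ a.1 < b.1).card ∧
    ((b.1 : ℤ) - b.2 ≤ (Finset.univ.filter fun a => R a b ∧ a.1 < b.1).card -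
      (Finset.univ.filter fun a => R a b ∧ a.2 < b.2).card)

/-! ### The poset of heaps and its rank function -/

namespace Heap

variable {n : ℕ}

@[ext]
theorem ext_rel {s t : Heap n} (hS : s.S = t.S) (hR : ∀ a b, s.R a b ↔ t.R a b) : s = t := by
  have : s.R = t.R := funext fun a => funext fun b => propext (hR a b)
  cases s; cases t
  simp only at hS this
  subst hS this
  rfl

instance : Finite (Heap n) :=
  Finite.of_injective (fun t : Heap n => (t.S, t.R)) fun s t h => by
    simp only [Prod.mk.injEq] at h
    exact ext_rel h.1 fun a b => by rw [h.2]

/-- `s ≤ t` if `s` consists of the labels of an initial part of `t`. -/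
instance : PartialOrder (Heap n) where
  -- Only `b ∈ s.S` is required on the right; with `mem_left` this forces `s.S` to be a lower set of
  -- `t`.
  le s t := s.S ⊆ t.S ∧ ∀ a b, s.R a b ↔ t.R a b ∧ b ∈ s.S
  le_refl t := ⟨subset_rfl, fun a b => ⟨fun h => ⟨h, t.mem_right h⟩, fun h => h.1⟩⟩
  le_trans r s t h h' := ⟨h.1.trans h'.1, fun a b => by
    rw [h.2, h'.2]
    exact ⟨fun k => ⟨k.1.1, k.2⟩, fun k => ⟨⟨k.1, h.1 k.2⟩, k.2⟩⟩⟩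
  le_antisymm s t h h' := by
    have hS := h.1.antisymm h'.1
    refine ext_rel hS fun a b => ?_
    rw [h.2, hS]
    exact ⟨fun k => k.1, fun k => ⟨k, t.mem_right k⟩⟩

theorem le_def {s t : Heap n} : s ≤ t ↔ s.S ⊆ t.S ∧ ∀ a b, s.R a b ↔ t.R a b ∧ b ∈ s.S := Iff.rfl

theorem eq_of_le_of_S {s t : Heap n} (h : s ≤ t) (hS : t.S ⊆ s.S) : s = t :=
  ext_rel (h.1.antisymm hS) fun a b => by
    rw [h.2]
    exact ⟨fun k => k.1, fun k => ⟨k, hS (t.mem_right k)⟩⟩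

/-- The heap of the labels in a lower set of a heap. -/
def restrict (t : Heap n) (I : Finset (Fin n × Fin n)) (hI : I ⊆ t.S)
    (hd : ∀ a b, t.R a b → b ∈ I → a ∈ I) : Heap n where
  S := I
  R a b := t.R a b ∧ b ∈ I
  mem_left h := hd _ _ h.1 h.2
  mem_right h := h.2
  crossing h := t.crossing h.1
  total a ha b hb h := (t.total a (hI ha) b (hI hb) h).imp (fun k => ⟨k, hb⟩) fun k => ⟨k, ha⟩
  acyclic := t.acyclic.imp fun _ hf a b h => hf a b h.1
  fst_inj a ha b hb := t.fst_inj a (hI ha) b (hI hb)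
  snd_inj a ha b hb := t.snd_inj a (hI ha) b (hI hb)
  good b hb := by
    have key : ∀ (p : Fin n × Fin n → Prop) [DecidablePred fun a => (t.R a b ∧ b ∈ I) ∧ p a]
        [DecidablePred fun a => t.R a b ∧ p a],
        (Finset.univ.filter fun a => (t.R a b ∧ b ∈ I) ∧ p a) =
          Finset.univ.filter fun a => t.R a b ∧ p a := fun p _ _ => by ext; simp [hb]
    classical
    rw [key, key]
    exact t.good b (hI hb)

theorem restrict_le (t : Heap n) (I : Finset (Fin n × Fin n)) (hI : I ⊆ t.S)
    (hd : ∀ a b, t.R a b → b ∈ I → a ∈ I) : t.restrict I hI hd ≤ t :=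
  ⟨hI, fun _ _ => Iff.rfl⟩

/-- The empty heap. -/
def empty (n : ℕ) : Heap n where
  S := ∅
  R _ _ := False
  mem_left h := h.elim
  mem_right h := h.elim
  crossing h := h.elim
  total a ha := by simp at ha
  acyclic := ⟨fun _ => 0, fun _ _ h => h.elim⟩
  fst_inj a ha := by simp at ha
  snd_inj a ha := by simp at ha
  good a ha := by simp at ha

theorem isBot_empty : IsBot (empty n) := fun t =>
  ⟨Finset.empty_subset _, fun _ _ => ⟨fun h => h.elim, fun h => by simp [empty] at h⟩⟩

theorem eq_empty_iff {t : Heap n} : t = empty n ↔ t.S = ∅ :=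
  ⟨fun h => h ▸ rfl, fun h => (eq_of_le_of_S (isBot_empty t) (by rw [h]; rfl)).symm⟩

open Classical in
/-- The labels of `t` that can come last. -/
noncomputable def top (t : Heap n) : Finset (Fin n × Fin n) := t.S.filter fun a => ∀ b, ¬ t.R a b

open Classical in
/-- The labels of `t` that can come first. -/
noncomputable def bottom (t : Heap n) : Finset (Fin n × Fin n) :=
  t.S.filter fun b => ∀ a, ¬ t.R a b

theorem mem_top {t : Heap n} {a : Fin n × Fin n} : a ∈ t.top ↔ a ∈ t.S ∧ ∀ b, ¬ t.R a b := by
  simp [top]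

theorem mem_bottom {t : Heap n} {b : Fin n × Fin n} :
    b ∈ t.bottom ↔ b ∈ t.S ∧ ∀ a, ¬ t.R a b := by
  simp [bottom]

theorem top_eq_empty_iff {t : Heap n} : t.top = ∅ ↔ t = empty n := by
  rw [eq_empty_iff]
  refine ⟨fun h => ?_, fun h => by simp [top, h]⟩
  by_contra hne
  obtain ⟨f, hf⟩ := t.acyclic
  obtain ⟨b, hb, hmax⟩ := Finset.exists_max_image t.S f (Finset.nonempty_iff_ne_empty.2 hne)
  have : b ∈ t.top := mem_top.2 ⟨hb, fun a ha => by
    have := hmax a (t.mem_right ha)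
    have := hf _ _ ha
    omega⟩
  simp [h] at this

theorem bottom_eq_empty_iff {t : Heap n} : t.bottom = ∅ ↔ t = empty n := by
  rw [eq_empty_iff]
  refine ⟨fun h => ?_, fun h => by simp [bottom, h]⟩
  by_contra hne
  obtain ⟨f, hf⟩ := t.acyclic
  obtain ⟨b, hb, hmin⟩ := Finset.exists_min_image t.S f (Finset.nonempty_iff_ne_empty.2 hne)
  have : b ∈ t.bottom := mem_bottom.2 ⟨hb, fun a ha => by
    have := hmin a (t.mem_left ha)
    have := hf _ _ ha
    omega⟩
  simp [h] at this

/-- Remove labels from the top of a heap. -/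
noncomputable def removeTop (t : Heap n) (T : Finset (Fin n × Fin n)) (hT : T ⊆ t.top) : Heap n :=
  t.restrict (t.S \ T) Finset.sdiff_subset fun _ _ h _ =>
    Finset.mem_sdiff.2 ⟨t.mem_left h, fun ha => (mem_top.1 (hT ha)).2 _ h⟩

/-- For `s < t`, a label of `t` outside `s` on the highest level is a top label of `t`. Removing it
gives a heap that is still above `s`. -/
theorem isRankFunction_card : IsRankFunction (fun t : Heap n => t.S.card) where
  strictMono s t h := Finset.card_lt_card
    (h.le.1.ssubset_of_ne fun e => h.ne (eq_of_le_of_S h.le e.ge))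
  isMin t h := by
    have : t = empty n := le_antisymm (h (isBot_empty t)) (isBot_empty t)
    simp [this, empty]
  covBy s t h := by
    have hne : (t.S \ s.S).Nonempty := by
      rw [Finset.sdiff_nonempty]
      exact fun hS => h.lt.ne (eq_of_le_of_S h.le hS)
    obtain ⟨f, hf⟩ := t.acyclic
    obtain ⟨b, hb, hmax⟩ := Finset.exists_max_image _ f hne
    rw [Finset.mem_sdiff] at hb
    have hbt : {b} ⊆ t.top := by
      rw [Finset.singleton_subset_iff, mem_top]
      refine ⟨hb.1, fun a ha => ?_⟩
      by_cases has : a ∈ s.S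
      · exact hb.2 (s.mem_left ((h.le.2 b a).2 ⟨ha, has⟩))
      · have := hmax a (Finset.mem_sdiff.2 ⟨t.mem_right ha, has⟩)
        have := hf _ _ ha
        omega
    have hle : s ≤ t.removeTop {b} hbt := by
      refine ⟨fun a ha => Finset.mem_sdiff.2 ⟨h.le.1 ha, fun e => hb.2 ?_⟩, fun x y => ?_⟩
      · rwa [← Finset.mem_singleton.1 e]
      · rw [h.le.2]
        refine ⟨fun k => ⟨⟨k.1, Finset.mem_sdiff.2 ⟨t.mem_right k.1, fun e => hb.2 ?_⟩⟩, k.2⟩,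
          fun k => ⟨k.1.1, k.2⟩⟩
        rw [← Finset.mem_singleton.1 e]
        exact k.2
    have hcard : (t.removeTop {b} hbt).S.card + 1 = t.S.card := by
      change (t.S \ {b}).card + 1 = _
      rw [Finset.sdiff_singleton_eq_erase, Finset.card_erase_add_one hb.1]
    have hlt : t.removeTop {b} hbt < t := lt_of_le_of_ne (t.restrict_le _ _ _)
      fun e => by rw [e] at hcard; omega
    have : s = t.removeTop {b} hbt := by
      by_contra hne'
      exact h.2 (lt_of_le_of_ne hle hne') hlt
    change t.S.card = s.S.card + 1
    rw [this, hcard]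

/-! ### From heaps to lattice path matroids -/

open Classical in
theorem card_balance (t : Heap n) {b : Fin n × Fin n} (hb : b ∈ t.top) :
    (Finset.univ.filter fun a => t.R a b ∧ a.1 < b.1).card +
        pathHeight (t.S.image Prod.snd) b.2 =
      (Finset.univ.filter fun a => t.R a b ∧ a.2 < b.2).card +
        pathHeight (t.S.image Prod.fst) b.1 := by
  rw [mem_top] at hb
  have hR : ∀ a, t.R a b ↔ a ∈ t.S ∧ Crossing a b := fun a =>
    ⟨fun h => ⟨t.mem_left h, t.crossing h⟩, fun h =>
      (t.total a h.1 b hb.1 h.2).resolve_right (hb.2 a)⟩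
  have hf : ∀ (p : Fin n × Fin n → Prop) [DecidablePred p], (Finset.univ.filter fun a => t.R a b ∧ p a) =
      t.S.filter fun a => Crossing a b ∧ p a := fun p _ => by
    ext a
    simp [hR, and_assoc]
  rw [pathHeight_image_fst t.fst_inj, pathHeight_image_snd t.snd_inj, hf, hf]
  refine card_crossing_balance t.S b fun a ha => ?_
  by_cases hab : a = b
  · exact Or.inl hab
  · exact Or.inr ⟨fun e => hab (t.fst_inj a ha b hb.1 e), fun e => hab (t.snd_inj a ha b hb.1 e)⟩

/-- All labels that cross a top label precede it, so the counts in `Heap.good` become the heights of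
the two full paths. -/
theorem good_top (t : Heap n) {b : Fin n × Fin n} (hb : b ∈ t.top) :
    pathHeight (t.S.image Prod.snd) b.2 ≤ pathHeight (t.S.image Prod.fst) b.1 ∧
    ((b.1 : ℤ) - b.2 ≤ (pathHeight (t.S.image Prod.fst) b.1 : ℤ) -
      pathHeight (t.S.image Prod.snd) b.2) := by
  classical
  have h1 := t.card_balance hb
  have h2 := t.good b (mem_top.1 hb).1
  omega

theorem image_fst_sdiff (t : Heap n) {T : Finset (Fin n × Fin n)} (hT : T ⊆ t.S) :
    t.S.image Prod.fst \ (t.S \ T).image Prod.fst = T.image Prod.fst := by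
  rw [← Finset.image_sdiff_of_injOn (fun a ha b hb => t.fst_inj a ha b hb) Finset.sdiff_subset,
    Finset.sdiff_sdiff_eq_self hT]

theorem image_snd_sdiff (t : Heap n) {T : Finset (Fin n × Fin n)} (hT : T ⊆ t.S) :
    t.S.image Prod.snd \ (t.S \ T).image Prod.snd = T.image Prod.snd := by
  rw [← Finset.image_sdiff_of_injOn (fun a ha b hb => t.snd_inj a ha b hb) Finset.sdiff_subset,
    Finset.sdiff_sdiff_eq_self hT]

theorem top_subset (t : Heap n) : t.top ⊆ t.S := fun _ h => (mem_top.1 h).1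

theorem noncrossing (t : Heap n) (i : ℕ) :
    pathHeight (t.S.image Prod.snd) i ≤ pathHeight (t.S.image Prod.fst) i := by
  by_cases ht : t.top = ∅
  · rw [top_eq_empty_iff, eq_empty_iff] at ht
    simp [ht]
  obtain ⟨b, hb⟩ := Finset.nonempty_iff_ne_empty.2 ht
  have hbS := t.top_subset hb
  have hsub : {b} ⊆ t.top := Finset.singleton_subset_iff.2 hb
  have hlt : (t.removeTop {b} hsub).S.card < t.S.card :=
    Finset.card_lt_card (Finset.sdiff_ssubset (Finset.singleton_subset_iff.2 hbS) (by simp))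
  have ih := noncrossing (t.removeTop {b} hsub)
  have hU : ((t.S \ {b}).image Prod.fst) = (t.S.image Prod.fst).erase b.1 := by
    rw [Finset.image_sdiff_of_injOn (fun a ha b hb => t.fst_inj a ha b hb)
      (Finset.singleton_subset_iff.2 hbS), Finset.image_singleton,
      Finset.sdiff_singleton_eq_erase]
  have hL : ((t.S \ {b}).image Prod.snd) = (t.S.image Prod.snd).erase b.2 := by
    rw [Finset.image_sdiff_of_injOn (fun a ha b hb => t.snd_inj a ha b hb)
      (Finset.singleton_subset_iff.2 hbS), Finset.image_singleton,
      Finset.sdiff_singleton_eq_erase]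
  have hbU := Finset.mem_image_of_mem Prod.fst hbS
  have hbL := Finset.mem_image_of_mem Prod.snd hbS
  have e1 := pathHeight_erase hbU i
  have e2 := pathHeight_erase hbL i
  have e3 := ih i
  change pathHeight ((t.S \ {b}).image Prod.snd) i ≤ pathHeight ((t.S \ {b}).image Prod.fst) i at e3
  rw [hU, hL] at e3
  have hg := t.good_top hb
  -- Restoring `b` raises only the lower path for `b.2 < i ≤ b.1`. There both paths have slope
  -- between 0 and 1, and the bound on `b.1 - b.2` keeps them in order.
  by_cases hi : (b.2 : ℕ) < i ∧ i ≤ b.1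
  · have k1 := pathHeight_le_add (t.S.image Prod.fst) hi.2
    have k2 := pathHeight_le_add (t.S.image Prod.snd) hi.1.le
    omega
  · split_ifs at e1 e2 <;> omega
termination_by t.S.card

/-- The lattice path matroid at the top of the chains in the class of `t`. -/
def toLPM (t : Heap n) : LPM n where
  U := t.S.image Prod.fst
  L := t.S.image Prod.snd
  card_eq := by
    rw [Finset.card_image_of_injOn fun a ha b hb => t.fst_inj a ha b hb,
      Finset.card_image_of_injOn fun a ha b hb => t.snd_inj a ha b hb]
  noncrossing := t.noncrossing

theorem card_toLPM_U (t : Heap n) : t.toLPM.U.card = t.S.card :=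
  Finset.card_image_of_injOn fun a ha b hb => t.fst_inj a ha b hb

/-- Top labels do not cross each other, since crossing labels are related by `R`. Hence the two
diagrams determine the set of removed labels. -/
theorem matching_removeTop (t : Heap n) {T : Finset (Fin n × Fin n)} (hT : T ⊆ t.top) :
    matching (t.toLPM.U \ (t.removeTop T hT).toLPM.U) (t.toLPM.L \ (t.removeTop T hT).toLPM.L) =
      T := by
  have hTS := hT.trans t.top_subset
  change matching (t.S.image Prod.fst \ (t.S \ T).image Prod.fst)
    (t.S.image Prod.snd \ (t.S \ T).image Prod.snd) = T
  rw [t.image_fst_sdiff hTS, t.image_snd_sdiff hTS]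
  refine matching_image (fun a ha b hb => t.fst_inj a (hTS ha) b (hTS hb))
    (fun a ha b hb => t.snd_inj a (hTS ha) b (hTS hb)) fun a ha b hb hab => ?_
  rcases t.total a (hTS ha) b (hTS hb) hab with h | h
  · exact (mem_top.1 (hT ha)).2 _ h
  · exact (mem_top.1 (hT hb)).2 _ h

theorem toLPM_removeTop_le (t : Heap n) {T : Finset (Fin n × Fin n)} (hT : T ⊆ t.top) :
    (t.removeTop T hT).toLPM ≤ t.toLPM := by
  refine LPM.Dominates.le ⟨Finset.image_subset_image Finset.sdiff_subset,
    Finset.image_subset_image Finset.sdiff_subset, fun u hu l hl hul => ?_⟩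
  have hb : (u, l) ∈ T := by
    rw [← t.matching_removeTop hT]
    exact mem_matching.2 ⟨hu, hl, hul⟩
  exact (LPM.isGoodPair_iff _ _ _).2 ⟨(Finset.mem_sdiff.1 hl).1, (Finset.mem_sdiff.1 hu).1,
    t.good_top (hT hb)⟩

theorem rel_iff_removeTop (t : Heap n) {T : Finset (Fin n × Fin n)} (hT : T ⊆ t.top)
    (a b : Fin n × Fin n) : t.R a b ↔ (t.removeTop T hT).R a b ∨
      a ∈ (t.removeTop T hT).S ∧ b ∈ T ∧ Crossing a b := by
  change _ ↔ t.R a b ∧ b ∈ t.S \ T ∨ a ∈ t.S \ T ∧ b ∈ T ∧ Crossing a b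
  constructor
  · intro h
    by_cases hb : b ∈ T
    · exact Or.inr ⟨Finset.mem_sdiff.2 ⟨t.mem_left h, fun ha => (mem_top.1 (hT ha)).2 _ h⟩, hb,
        t.crossing h⟩
    · exact Or.inl ⟨h, Finset.mem_sdiff.2 ⟨t.mem_right h, hb⟩⟩
  · rintro (h | ⟨h1, h2, h3⟩)
    · exact h.1
    · exact (t.total a (Finset.mem_sdiff.1 h1).1 b (t.top_subset (hT h2)) h3).resolve_right
        ((mem_top.1 (hT h2)).2 a)

/-- A heap can be reconstructed after labels were removed from its top. -/
theorem removeTop_injective {s t : Heap n} {T T' : Finset (Fin n × Fin n)} (hT : T ⊆ s.top)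
    (hT' : T' ⊆ t.top) (h : s.toLPM = t.toLPM) (h' : s.removeTop T hT = t.removeTop T' hT') :
    s = t ∧ T = T' := by
  have e : T = T' := by
    rw [← s.matching_removeTop hT, ← t.matching_removeTop hT', h, h']
  subst e
  refine ⟨ext_rel ?_ fun a b => ?_, rfl⟩
  · have h1 : s.S \ T = t.S \ T := congrArg Heap.S h'
    rw [← Finset.sdiff_union_of_subset (hT.trans s.top_subset), h1,
      Finset.sdiff_union_of_subset (hT'.trans t.top_subset)]
  · rw [s.rel_iff_removeTop hT, t.rel_iff_removeTop hT', h']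

end Heap

/-! ### Adding labels on top of a heap -/

namespace Heap

variable {n : ℕ}

open Classical in
/-- The heap obtained by adding the paired off differences between `t` and `M` on top of `t`. -/
def addTop (t : Heap n) (M : LPM n) (hd : M.Dominates t.toLPM) : Heap n :=
  have hfst : ∀ b ∈ matching (M.U \ t.toLPM.U) (M.L \ t.toLPM.L), ∀ a ∈ t.S, a.1 ≠ b.1 :=
    fun b hb a ha e => (Finset.mem_sdiff.1 (mem_matching.1 hb).1).2
      (e ▸ Finset.mem_image_of_mem Prod.fst ha)
  have hsnd : ∀ b ∈ matching (M.U \ t.toLPM.U) (M.L \ t.toLPM.L), ∀ a ∈ t.S, a.2 ≠ b.2 :=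
    fun b hb a ha e => (Finset.mem_sdiff.1 (mem_matching.1 hb).2.1).2
      (e ▸ Finset.mem_image_of_mem Prod.snd ha)
  { S := t.S ∪ matching (M.U \ t.toLPM.U) (M.L \ t.toLPM.L)
    R := fun a b => t.R a b ∨
      a ∈ t.S ∧ b ∈ matching (M.U \ t.toLPM.U) (M.L \ t.toLPM.L) ∧ Crossing a b
    mem_left := fun h => Finset.mem_union_left _ (h.elim t.mem_left fun k => k.1)
    mem_right := fun h => Finset.mem_union.2 (h.imp t.mem_right fun k => k.2.1)
    crossing := fun h => h.elim t.crossing fun k => k.2.2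
    total := by
      intro a ha b hb hab
      rcases Finset.mem_union.1 ha with ha | ha <;> rcases Finset.mem_union.1 hb with hb | hb
      · exact (t.total a ha b hb hab).imp Or.inl Or.inl
      · exact Or.inl (Or.inr ⟨ha, hb, hab⟩)
      · exact Or.inr (Or.inr ⟨hb, ha, hab.symm⟩)
      · exact absurd hab (not_crossing_of_mem_matching ha hb)
    acyclic := by
      obtain ⟨f, hf⟩ := t.acyclic
      -- Matched labels do not cross each other, so one new level suffices for all of them.
      refine ⟨fun a => if a ∈ t.S then f a else t.S.sup f + 1, fun a b h => ?_⟩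
      rcases h with h | ⟨ha, hb, -⟩
      · simp only [if_pos (t.mem_left h), if_pos (t.mem_right h)]
        exact hf a b h
      · have hb' : b ∉ t.S := fun k => hfst b hb b k rfl
        simp only [if_pos ha, if_neg hb']
        exact Nat.lt_succ_of_le (Finset.le_sup ha)
    fst_inj := by
      intro a ha b hb e
      rcases Finset.mem_union.1 ha with ha | ha <;> rcases Finset.mem_union.1 hb with hb | hb
      · exact t.fst_inj a ha b hb e
      · exact absurd e (hfst b hb a ha)
      · exact absurd e.symm (hfst a ha b hb)
      · exact matching_fst_injOn ha hb e
    snd_inj := by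
      intro a ha b hb e
      rcases Finset.mem_union.1 ha with ha | ha <;> rcases Finset.mem_union.1 hb with hb | hb
      · exact t.snd_inj a ha b hb e
      · exact absurd e (hsnd b hb a ha)
      · exact absurd e.symm (hsnd a ha b hb)
      · exact matching_snd_injOn ha hb e
    good := by
      intro b hb
      by_cases hbS : b ∈ t.S
      · have hb' : b ∉ matching (M.U \ t.toLPM.U) (M.L \ t.toLPM.L) :=
          fun k => hfst b k b hbS rfl
        have key : ∀ (p : Fin n × Fin n → Prop) [DecidablePred fun a => (t.R a b ∨ a ∈ t.S ∧
            b ∈ matching (M.U \ t.toLPM.U) (M.L \ t.toLPM.L) ∧ Crossing a b) ∧ p a]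
            [DecidablePred fun a => t.R a b ∧ p a],
            (Finset.univ.filter fun a => (t.R a b ∨ a ∈ t.S ∧
              b ∈ matching (M.U \ t.toLPM.U) (M.L \ t.toLPM.L) ∧ Crossing a b) ∧ p a) =
            Finset.univ.filter fun a => t.R a b ∧ p a := fun p _ _ => by ext; simp [hb']
        rw [key, key]
        exact t.good b hbS
      · have hbm := (Finset.mem_union.1 hb).resolve_left hbS
        have hbR : ∀ a, ¬ t.R a b := fun a h => hbS (t.mem_right h)
        have key : ∀ (p : Fin n × Fin n → Prop) [DecidablePred fun a => (t.R a b ∨ a ∈ t.S ∧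
            b ∈ matching (M.U \ t.toLPM.U) (M.L \ t.toLPM.L) ∧ Crossing a b) ∧ p a]
            [DecidablePred fun a => Crossing a b ∧ p a],
            (Finset.univ.filter fun a => (t.R a b ∨ a ∈ t.S ∧
              b ∈ matching (M.U \ t.toLPM.U) (M.L \ t.toLPM.L) ∧ Crossing a b) ∧ p a) =
            t.S.filter fun a => Crossing a b ∧ p a := fun p _ _ => by
              ext; simp [hbm, hbR, and_assoc]
        rw [key, key]
        have h1 := card_crossing_balance t.S b
          fun a ha => Or.inr ⟨hfst b hbm a ha, hsnd b hbm a ha⟩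
        rw [← pathHeight_image_fst t.fst_inj, ← pathHeight_image_snd t.snd_inj] at h1
        -- At `b`, the heights of `M` exceed those of `t` by the same amount in both paths, namely
        -- the position of `b` in the matching.
        obtain ⟨hbU, hbL, hUL⟩ := mem_matching.1 hbm
        have h2 := (LPM.isGoodPair_iff _ _ _).1 (hd.good b.1 hbU b.2 hbL hUL)
        have h3 := pathHeight_sdiff hd.subset_U b.1
        have h4 := pathHeight_sdiff hd.subset_L b.2
        simp only [toLPM] at h3 h4 hUL
        omega }

theorem addTop_S (t : Heap n) (M : LPM n) (hd : M.Dominates t.toLPM) :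
    (t.addTop M hd).S = t.S ∪ matching (M.U \ t.toLPM.U) (M.L \ t.toLPM.L) := rfl

theorem addTop_R (t : Heap n) (M : LPM n) (hd : M.Dominates t.toLPM) (a b : Fin n × Fin n) :
    (t.addTop M hd).R a b ↔ t.R a b ∨
      a ∈ t.S ∧ b ∈ matching (M.U \ t.toLPM.U) (M.L \ t.toLPM.L) ∧ Crossing a b := Iff.rfl

theorem disjoint_matching (t : Heap n) (M : LPM n) :
    Disjoint t.S (matching (M.U \ t.toLPM.U) (M.L \ t.toLPM.L)) := by
  rw [Finset.disjoint_left]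
  intro a ha hb
  exact (Finset.mem_sdiff.1 (mem_matching.1 hb).1).2 (Finset.mem_image_of_mem Prod.fst ha)

theorem toLPM_addTop (t : Heap n) (M : LPM n) (hd : M.Dominates t.toLPM) :
    (t.addTop M hd).toLPM = M := by
  refine LPM.ext_paths ?_ ?_
  · change (t.S ∪ _).image Prod.fst = M.U
    rw [Finset.image_union, image_fst_matching hd.card_sdiff]
    exact Finset.union_sdiff_of_subset hd.subset_U
  · change (t.S ∪ _).image Prod.snd = M.L
    rw [Finset.image_union, image_snd_matching hd.card_sdiff]
    exact Finset.union_sdiff_of_subset hd.subset_L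

theorem matching_subset_top_addTop (t : Heap n) (M : LPM n) (hd : M.Dominates t.toLPM) :
    matching (M.U \ t.toLPM.U) (M.L \ t.toLPM.L) ⊆ (t.addTop M hd).top := by
  intro a ha
  have ha' : a ∉ t.S := fun h => Finset.disjoint_left.1 (t.disjoint_matching M) h ha
  refine mem_top.2 ⟨Finset.mem_union_right _ ha, fun b h => ?_⟩
  rcases (t.addTop_R M hd a b).1 h with h | h
  · exact ha' (t.mem_left h)
  · exact ha' h.1

theorem removeTop_addTop (t : Heap n) (M : LPM n) (hd : M.Dominates t.toLPM) :
    (t.addTop M hd).removeTop _ (t.matching_subset_top_addTop M hd) = t := by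
  have hS : (t.S ∪ matching (M.U \ t.toLPM.U) (M.L \ t.toLPM.L)) \
      matching (M.U \ t.toLPM.U) (M.L \ t.toLPM.L) = t.S :=
    Finset.union_sdiff_cancel_right (t.disjoint_matching M)
  refine ext_rel hS fun a b => ?_
  change (t.addTop M hd).R a b ∧ b ∈ _ \ _ ↔ _
  rw [addTop_R, addTop_S, hS]
  constructor
  · rintro ⟨h | h, hb⟩
    · exact h
    · exact absurd h.2.1 (Finset.disjoint_left.1 (t.disjoint_matching M) hb)
  · intro h
    exact ⟨Or.inl h, t.mem_right h⟩

end Heap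

/-! ## The Möbius functions and the Whitney numbers -/

section Moebius

variable {P : Type*} [PartialOrder P] [Fintype P]

open Classical in
theorem sum_moebius (z y : P) (hz : IsBot z) :
    ∑ x with x ≤ y, moebius P z x = if y = z then 1 else 0 := by
  let _ : Fintype P := Fintype.ofFinite P
  let _ : LocallyFiniteOrder P := Fintype.toLocallyFiniteOrder
  have h := IncidenceAlgebra.sum_Icc_mu_right (𝕜 := ℤ) z y
  simp only [eq_comm (a := z)] at h
  rw [← h]
  refine Finset.sum_congr ?_ fun x _ => rfl
  ext x
  simp [hz x]

open Classical in
/-- A function with the summation property of the Möbius function is the Möbius function. -/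
theorem moebius_eq (z : P) (hz : IsBot z) (f : P → ℤ)
    (hf : ∀ y, ∑ x with x ≤ y, f x = if y = z then 1 else 0) (y : P) : moebius P z y = f y := by
  induction y using WellFoundedLT.induction with
  | ind y ih =>
    have h := (sum_moebius z y hz).trans (hf y).symm
    have hs : (Finset.univ.filter fun x => x ≤ y) =
        insert y (Finset.univ.filter fun x => x < y) := by
      ext x
      simp [le_iff_eq_or_lt]
    rw [hs, Finset.sum_insert (by simp), Finset.sum_insert (by simp)] at h
    have h' : ∑ x with x < y, moebius P z x = ∑ x with x < y, f x :=
      Finset.sum_congr rfl fun x hx => ih x (Finset.mem_filter.1 hx).2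
    omega

open Classical in
theorem whitneyFirst_eq (ρ : P → ℕ) (z : P) (k : ℕ) :
    whitneyFirst ρ z k = ∑ x with ρ x = k, moebius P z x := by
  rw [whitneyFirst, finsum_eq_sum_of_fintype, Finset.sum_filter]
  exact Finset.sum_congr rfl fun x _ => finsum_eq_if

end Moebius

open Classical in
theorem whitneySecond_eq {P : Type*} [Fintype P] (ρ : P → ℕ) (k : ℕ) :
    whitneySecond ρ k = (Finset.univ.filter fun x => ρ x = k).card := by
  rw [whitneySecond, ← Set.ncard_coe_finset]
  congr 1
  ext
  simp


/-! ### The Möbius functions of both posets -/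

namespace Heap

variable {n : ℕ}

noncomputable instance : Fintype (Heap n) := Fintype.ofFinite _

noncomputable instance : Fintype (LPM n) := Fintype.ofFinite _

/-- The heaps in which no two labels cross. -/
def IsAntichain (t : Heap n) : Prop := ∀ a b, ¬ t.R a b

theorem IsAntichain.top_eq {t : Heap n} (h : t.IsAntichain) : t.top = t.S := by
  ext a
  rw [mem_top]
  exact and_iff_left (h a)

-- The heaps without crossings below `t` are the subsets of its bottom labels. Their alternating sum
-- vanishes unless there is no bottom label, that is, unless `t` is empty.
open Classical in
theorem moebius_heap (t : Heap n) : moebius (Heap n) (empty n) t =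
    if t.IsAntichain then (-1) ^ t.S.card else 0 := by
  refine moebius_eq _ isBot_empty
    (fun t : Heap n => if t.IsAntichain then (-1) ^ t.S.card else 0) (fun t => ?_) t
  rw [← Finset.sum_filter, Finset.filter_filter]
  have hb : (t = empty n) = (t.bottom = ∅) := propext bottom_eq_empty_iff.symm
  simp only [hb]
  rw [← Finset.sum_powerset_neg_one_pow_card]
  refine Finset.sum_bij (fun s _ => s.S) ?_ ?_ ?_ fun _ _ => rfl
  · intro s hs
    simp only [Finset.mem_filter, Finset.mem_univ, true_and] at hs
    refine Finset.mem_powerset.2 fun b hb => mem_bottom.2 ⟨hs.1.1 hb, fun a h => ?_⟩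
    exact hs.2 a b ((hs.1.2 a b).2 ⟨h, hb⟩)
  · intro s hs s' hs' h
    simp only [Finset.mem_filter, Finset.mem_univ, true_and] at hs hs'
    exact ext_rel h fun a b => ⟨fun k => absurd k (hs.2 a b), fun k => absurd k (hs'.2 a b)⟩
  · intro T hT
    rw [Finset.mem_powerset] at hT
    refine ⟨t.restrict T (fun b hb => (mem_bottom.1 (hT hb)).1)
      (fun a b h hb => absurd h ((mem_bottom.1 (hT hb)).2 a)), ?_, rfl⟩
    simp only [Finset.mem_filter, Finset.mem_univ, true_and]
    exact ⟨t.restrict_le _ _ _, fun a b h => (mem_bottom.1 (hT h.2)).2 a h.1⟩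

-- `removeTop` and `addTop` identify the heaps over some `M' ≤ M` with the pairs of a heap over `M`
-- and a set of its top labels. The sum over these sets vanishes unless the heap is empty.
open Classical in
theorem sum_heap_le (M : LPM n) :
    ∑ t : Heap n with t.toLPM ≤ M, (-1 : ℤ) ^ t.S.card = if M = LPM.empty n then 1 else 0 := by
  have h1 : ∑ t : Heap n with t.toLPM ≤ M, (-1 : ℤ) ^ t.S.card =
      ∑ x ∈ (Finset.univ.filter fun t : Heap n => t.toLPM = M).sigma fun t => t.top.powerset,
        (-1 : ℤ) ^ x.1.S.card * (-1) ^ x.2.card := by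
    symm
    refine Finset.sum_bij (fun x hx => x.1.removeTop x.2
      (Finset.mem_powerset.1 (Finset.mem_sigma.1 hx).2)) ?_ ?_ ?_ ?_
    · rintro ⟨t, T⟩ hx
      simp only [Finset.mem_sigma, Finset.mem_filter, Finset.mem_univ, true_and] at hx ⊢
      exact (t.toLPM_removeTop_le _).trans_eq hx.1
    · rintro ⟨t, T⟩ hx ⟨s, T'⟩ hx' h
      simp only [Finset.mem_sigma, Finset.mem_filter, Finset.mem_univ, true_and] at hx hx'
      obtain ⟨rfl, rfl⟩ := removeTop_injective _ _ (hx.1.trans hx'.1.symm) h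
      rfl
    · intro t ht
      simp only [Finset.mem_filter, Finset.mem_univ, true_and] at ht
      have hd := LPM.dominates_of_le ht
      refine ⟨⟨t.addTop M hd, _⟩, ?_, t.removeTop_addTop M hd⟩
      simp only [Finset.mem_sigma, Finset.mem_filter, Finset.mem_univ, true_and,
        Finset.mem_powerset]
      exact ⟨t.toLPM_addTop M hd, t.matching_subset_top_addTop M hd⟩
    · rintro ⟨t, T⟩ hx
      simp only [Finset.mem_sigma, Finset.mem_powerset] at hx
      have hc : (t.S \ T).card + T.card = t.S.card :=
        Finset.card_sdiff_add_card_eq_card (hx.2.trans t.top_subset)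
      change (-1 : ℤ) ^ t.S.card * (-1) ^ T.card = (-1) ^ (t.S \ T).card
      rw [← hc, pow_add, mul_assoc, ← mul_pow]
      simp
  rw [h1, Finset.sum_sigma]
  simp only [← Finset.mul_sum, Finset.sum_powerset_neg_one_pow_card, top_eq_empty_iff]
  have h2 : ∀ t : Heap n, (-1 : ℤ) ^ t.S.card * (if t = empty n then 1 else 0) =
      if t = empty n then 1 else 0 := by
    intro t
    split_ifs with h
    · simp [h, empty]
    · simp
  simp only [h2, Finset.sum_ite_eq', Finset.mem_filter, Finset.mem_univ, true_and]
  have h3 : (empty n).toLPM = LPM.empty n := LPM.ext_paths rfl rfl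
  simp only [h3, eq_comm]

open Classical in
theorem moebius_lpm (M : LPM n) : moebius (LPM n) (LPM.empty n) M =
    ∑ t : Heap n with t.toLPM = M, (-1 : ℤ) ^ t.S.card := by
  refine moebius_eq _ LPM.isBot_empty
    (fun M : LPM n => ∑ t : Heap n with t.toLPM = M, (-1 : ℤ) ^ t.S.card) (fun M => ?_) M
  rw [← sum_heap_le, ← Finset.sum_fiberwise_of_maps_to (g := toLPM)
    (t := Finset.univ.filter fun M' => M' ≤ M) (fun t ht => by simpa using ht)]
  refine Finset.sum_congr rfl fun M' hM' => Finset.sum_congr ?_ fun _ _ => rfl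
  simp only [Finset.mem_filter, Finset.mem_univ, true_and] at hM'
  ext t
  simp only [Finset.mem_filter, Finset.mem_univ, true_and]
  exact ⟨fun h => ⟨h ▸ hM', h⟩, fun h => h.2⟩

open Classical in
/-- Every lattice path matroid is at the top of exactly one increasing chain from the minimum. -/
theorem card_antichain_eq (k : ℕ) :
    (Finset.univ.filter fun t : Heap n => t.S.card = k ∧ t.IsAntichain).card =
      (Finset.univ.filter fun M : LPM n => M.U.card = k).card := by
  refine Finset.card_bij (fun t _ => t.toLPM) ?_ ?_ ?_
  · intro t ht
    simp only [Finset.mem_filter, Finset.mem_univ, true_and] at ht ⊢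
    rw [card_toLPM_U, ht.1]
  · intro s hs t ht h
    simp only [Finset.mem_filter, Finset.mem_univ, true_and] at hs ht
    -- Without crossings every label is on top, and removing all of them leaves the empty heap on
    -- both sides.
    refine (removeTop_injective hs.2.top_eq.ge ht.2.top_eq.ge h ?_).1
    rw [eq_empty_iff.2 (show (s.removeTop s.S _).S = ∅ from Finset.sdiff_self _),
      eq_empty_iff.2 (show (t.removeTop t.S _).S = ∅ from Finset.sdiff_self _)]
  · intro M hM
    simp only [Finset.mem_filter, Finset.mem_univ, true_and] at hM
    have h3 : (empty n).toLPM = LPM.empty n := LPM.ext_paths rfl rfl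
    have hd : M.Dominates (empty n).toLPM := LPM.dominates_of_le (h3 ▸ LPM.isBot_empty M)
    refine ⟨(empty n).addTop M hd, ?_, toLPM_addTop _ M hd⟩
    simp only [Finset.mem_filter, Finset.mem_univ, true_and]
    refine ⟨by rw [← card_toLPM_U, toLPM_addTop, hM], fun a b h => ?_⟩
    rcases (addTop_R _ M hd a b).1 h with h | h
    · exact h
    · simp [empty] at h

/-- On each rank all nonzero contributions have the sign `(-1)^k`, so the absolute values count
heaps, respectively heaps without crossings. -/
theorem isWhitneyDual : IsWhitneyDual (Heap n) (LPM n) := by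
  classical
  refine ⟨fun t => t.S.card, fun M => M.U.card, empty n, LPM.empty n, isRankFunction_card,
    LPM.isRankFunction_card, isBot_empty, LPM.isBot_empty, fun k => ⟨?_, ?_⟩⟩
  · have h : whitneyFirst (fun M : LPM n => M.U.card) (LPM.empty n) k =
        ∑ t : Heap n with t.S.card = k, (-1 : ℤ) ^ k := by
      rw [whitneyFirst_eq, ← Finset.sum_fiberwise_of_maps_to (g := toLPM)
        (s := Finset.univ.filter fun t : Heap n => t.S.card = k)
        (t := Finset.univ.filter fun M : LPM n => M.U.card = k)
        (fun t ht => by simpa [card_toLPM_U] using ht)]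
      refine Finset.sum_congr rfl fun M hM => ?_
      simp only [Finset.mem_filter, Finset.mem_univ, true_and] at hM
      rw [moebius_lpm, Finset.filter_filter]
      refine Finset.sum_congr ?_ fun t ht => ?_
      · ext t
        simp only [Finset.mem_filter, Finset.mem_univ, true_and]
        exact ⟨fun h => ⟨by rw [← card_toLPM_U, h, hM], h⟩, fun h => h.2⟩
      · rw [(Finset.mem_filter.1 ht).2.1]
    rw [h, Finset.sum_const, nsmul_eq_mul, abs_mul, abs_pow, abs_neg, abs_one, one_pow, mul_one,
      whitneySecond_eq, Nat.abs_cast]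
  · have h : whitneyFirst (fun t : Heap n => t.S.card) (empty n) k =
        ∑ t : Heap n with t.S.card = k ∧ t.IsAntichain, (-1 : ℤ) ^ k := by
      rw [whitneyFirst_eq, ← Finset.filter_filter, Finset.sum_filter (p := IsAntichain)]
      refine Finset.sum_congr rfl fun t ht => ?_
      rw [moebius_heap, (Finset.mem_filter.1 ht).2]
    rw [h, Finset.sum_const, nsmul_eq_mul, abs_mul, abs_pow, abs_neg, abs_one, one_pow, mul_one,
      whitneySecond_eq, Nat.abs_cast, card_antichain_eq]

end Heap

theorem proposition4p2 (n : ℕ) :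
    -- the poset is graded, by the rank of the matroid
    IsRankFunction (fun M : LPM n => M.U.card) ∧
    -- the good pair labeling exists and is an EW-labeling;
    -- its increasing chains are also unique as weakly increasing chains
    (∃ lab : EdgeLabeling (LPM n) (LabelPoset n),
      IsGoodPairLabeling lab ∧ lab.IsEW ∧
      ∀ x y : LPM n, x ≤ y →
        ∃! c : SaturatedChain (LPM n), c.FromTo x y ∧ lab.WeaklyIncreasing c) ∧
    -- the poset has a Whitney dual
    ∃ (Q : Type) (_ : PartialOrder Q) (_ : Finite Q), IsWhitneyDual Q (LPM n) :=
  ⟨LPM.isRankFunction_card,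
    ⟨LPM.goodPairLabeling n, LPM.isGoodPairLabeling_goodPairLabeling, LPM.isEW,
      fun _ _ h => LPM.existsUnique_weaklyIncreasing h⟩,
    Heap n, inferInstance, inferInstance, Heap.isWhitneyDual⟩
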